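/- Let $M,a,e,\Lambda\in\mathbb R$, $\Xi=1+\frac{a^2\Lambda}{3}\neq0$, $\Delta_\theta=1+\frac{a^2\Lambda}{3}\cos^2\theta$, $\Delta_r=(1-\frac{\Lambda}{3}r^2)(r^2+a^2)-2Mr+e^2$, $\rho^2=r^2+a^2\cos^2\theta$, $\bar\rho=r+ia\cos\theta$, $\bar\rho^*=r-ia\cos\theta$. The Kerr–Newman–(anti) de Sitter metric (signature $+---$) and electromagnetic potential are $$ds^2=\frac{\Delta_r}{\Xi^2\rho^2}(dt-a\sin^2\theta\,d\phi)^2-\frac{\rho^2}{\Delta_r}dr^2-\frac{\rho^2}{\Delta_\theta}d\theta^2-\frac{\Delta_\theta\sin^2\theta}{\Xi^2\rho^2}(a\,dt-(r^2+a^2)d\phi)^2,\qquad A=-\frac{er}{\Xi\rho^2}(dt-a\sin^2\theta\,d\phi).$$ Consider, in coordinates $(t,r,\theta,\phi)$, the vectors $$l=\Big(\tfrac{(r^2+a^2)\Xi}{\Delta_r},1,0,\tfrac{a\Xi}{\Delta_r}\Big),\quad n=\tfrac{1}{2\rho^2}\big(\Xi(r^2+a^2),-\Delta_r,0,a\Xi\big),\quad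 m=\tfrac{1}{\bar\rho\sqrt{2\Delta_\theta}}\Big(ia\Xi\sin\theta,0,\Delta_\theta,\tfrac{i\Xi}{\sin\theta}\Big),\quad \overline m .$$ The Dirac equation for a particle of charge $q$ and mass $\mu_*$ is the system, for two-spinors $P,Q$, $$(\nabla_{A\dot B}+iqA_{A\dot B})P^A+i\mu_*\overline Q_{\dot B}=0,\qquad(\nabla_{A\dot B}-iqA_{A\dot B})Q^A+i\mu_*\overline P_{\dot B}=0,$$ taken in the spin dyad of this tetrad. Let $\mu_*=\mu/\sqrt2$, with $q,\mu,m\in\mathbb R$ and $\omega\in\mathbb C$. **(A)** At every point with $0<\theta<\pi$, $\Delta_\theta>0$, $\Delta_r\ne0$, $\rho^2\neq0$: 1. $(l,n,m,\overline m)$ is a null tetrad with $l\cdot n=1$, $m\cdot\overline m=-1$, all other products being zero. 2. Its Newman–Penrose spin coefficients are $\kappa=\sigma=\lambda_{NP}=\nu=\varepsilon=0$ and $$\pi=\frac{ia\sin\theta\sqrt{2\Delta_\theta}}{2(\bar\rho^*)^2},\quad \beta=\frac{1}{2\sqrt2\,\bar\rho\sin\theta}\frac{d}{d\theta}(\sqrt{\Delta_\theta}\sin\theta),\quad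 \gamma=\frac{1}{4\rho^2}\frac{d\Delta_r}{dr}-\frac{\Delta_r}{2\rho^2\bar\rho^*},\quad \varrho=-\frac1{\bar\rho^*},$$ $$\mu_{NP}=-\frac{\Delta_r}{2\rho^2\bar\rho^*},\quad \tau=-\frac{i\sqrt{2\Delta_\theta}\,a\sin\theta}{2\rho^2},\quad \alpha=\pi-\beta^* .$$ 3. The components $\dot B=\dot 1,\dot 0$ of the first spinor equation are, with $D=l^\mu\partial_\mu$, $D'=n^\mu\partial_\mu$, $\delta=m^\mu\partial_\mu$, $\delta'=\overline m^\mu\partial_\mu$, $$(D'-\gamma+\mu_{NP}+iqn^\mu A_\mu)P^{(1)}+(\delta-\tau+\beta+iqm^\mu A_\mu)P^{(0)}=-i\mu_*\overline Q^{(\dot0)},$$ $$(-D+\varrho-\varepsilon-iql^\mu A_\mu)P^{(0)}+(-\delta'+\alpha-\pi-iq\overline m^\mu A_\mu)P^{(1)}=-i\mu_*\overline Q^{(\dot1)},$$ and those of the second one are the same with $(P,Q,q)$ replaced by $(Q,P,-q)$. 4. On fields $e^{i(m\phi-\omega t)}f(r,\theta)$, with $K=ma-\omega(r^2+a^2)$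 and $H=\omega a\sin\theta-\frac m{\sin\theta}$, these derivatives act on $f$ as $$D=\partial_r+\frac{i\Xi K}{\Delta_r},\quad D'=-\frac{\Delta_r}{2\rho^2}\Big(\partial_r-\frac{i\Xi K}{\Delta_r}\Big),\quad \delta=\frac{\sqrt{\Delta_\theta}}{\sqrt2\bar\rho}\Big(\partial_\theta+\frac{\Xi H}{\Delta_\theta}\Big),\quad \delta'=\frac{\sqrt{\Delta_\theta}}{\sqrt2\bar\rho^*}\Big(\partial_\theta-\frac{\Xi H}{\Delta_\theta}\Big).$$ **(B)** Let $I\subseteq\mathbb R$, $J\subseteq(0,\pi)$ be open with $\Delta_r>0$ on $I$, $\Delta_\theta>0$ on $J$ and $\rho^2\ne0$ on $I\times J$, and let $R^{(\pm)}$ and $S^{(\pm)}$ be complex-valued functions, differentiable on $I$ and on $J$ respectively. Put $$P^{(0)}=\frac{e^{i(m\phi-\omega t)}S^{(-)}R^{(-)}}{\sqrt2\,\bar\rho^*},\quad P^{(1)}=\frac{e^{i(m\phi-\omega t)}S^{(+)}R^{(+)}}{\sqrt{\Delta_r}},\quad \overline Q^{(\dot0)}=-\frac{e^{i(m\phi-\omega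 t)}S^{(+)}R^{(-)}}{\sqrt2\,\bar\rho},\quad \overline Q^{(\dot1)}=\frac{e^{i(m\phi-\omega t)}S^{(-)}R^{(+)}}{\sqrt{\Delta_r}} .$$ If, for some $\lambda\in\mathbb C$, $$\sqrt{\Delta_r}\Big\{\frac{dR^{(-)}}{dr}+\frac{i\Xi K}{\Delta_r}R^{(-)}-\frac{iqer}{\Delta_r}R^{(-)}\Big\}=(\lambda+i\mu r)R^{(+)},$$ $$\sqrt{\Delta_r}\frac{dR^{(+)}}{dr}-\frac{i\Xi K}{\sqrt{\Delta_r}}R^{(+)}+\frac{ieqr}{\sqrt{\Delta_r}}R^{(+)}=(\lambda-i\mu r)R^{(-)}$$ on $I$ and $$\sqrt{\Delta_\theta}\frac{dS^{(+)}}{d\theta}-\frac{\Xi H}{\sqrt{\Delta_\theta}}S^{(+)}+\frac{1}{2\sin\theta}\frac{d(\sqrt{\Delta_\theta}\sin\theta)}{d\theta}S^{(+)}=(-\lambda+\mu a\cos\theta)S^{(-)},$$ $$\sqrt{\Delta_\theta}\frac{dS^{(-)}}{d\theta}+\frac{\Xi H}{\sqrt{\Delta_\theta}}S^{(-)}+\frac{1}{2\sin\theta}\frac{d(\sqrt{\Delta_\theta}\sin\theta)}{d\theta}S^{(-)}=(\lambda+\mu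 a\cos\theta)S^{(+)}$$ on $J$, then $(P,Q)$ solves the Dirac equation for $r\in I$, $\theta\in J$. Conversely, if $(P,Q)$ solves the Dirac equation there, and neither $(R^{(-)},R^{(+)})$ vanishes identically on $I$ nor $(S^{(-)},S^{(+)})$ on $J$, then there is a constant $\lambda\in\mathbb C$ such that these four equations hold. **(C)** In the situation of (B) with $\Lambda=0$, put $\Delta=r^2+a^2+e^2-2Mr$. The four equations are then equivalent to Page's Kerr–Newman equations: the two radial equations with $\Xi=1$ and $\Delta_r=\Delta$, and $$\frac{dS^{(+)}}{d\theta}+\Big[\frac m{\sin\theta}-\omega a\sin\theta+\frac{\cot\theta}2\Big]S^{(+)}=(-\lambda+\mu a\cos\theta)S^{(-)},$$ $$\frac{dS^{(-)}}{d\theta}+\Big[\omega a\sin\theta-\frac m{\sin\theta}+\frac{\cot\theta}2\Big]S^{(-)}=(\lambda+\mu a\cos\theta)S^{(+)}.$$ If the radial ones hold on $I$ then, with $\mathcal K=(r^2+a^2)\omega-ma+eqr$, at every $r\in I$ with $\lambda+i\mu r\neq0$ the function $R^{(-)}$ is twice differentiable and $$\Big[\Delta\frac{d^2}{dr^2}+\Big(r-M-\frac{i\mu\Delta}{\lambda+i\mu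 r}\Big)\frac d{dr}+\frac{\mathcal K^2+i(r-M)\mathcal K}{\Delta}-2i\omega r-ieq-\frac{\mu\mathcal K}{\lambda+i\mu r}-\mu^2r^2-\lambda^2\Big]R^{(-)}=0.$$ If the angular ones hold on $J$ then, at every $\theta\in J$ with $\lambda+\mu a\cos\theta\ne0$, $S^{(-)}$ is twice differentiable and $$\frac{\mu a^2\omega\sin^2\theta-\mu am+\frac{\mu a}2\cos\theta}{\lambda+\mu a\cos\theta}S^{(-)}+\frac{\mu a\sin\theta}{\lambda+\mu a\cos\theta}\frac{dS^{(-)}}{d\theta}+\frac{d^2S^{(-)}}{d\theta^2}+\cot\theta\frac{dS^{(-)}}{d\theta}$$ $$+\Big[\omega a\cos\theta+\frac{m\cos\theta}{\sin^2\theta}-\frac1{2\sin^2\theta}-\Big(\omega a\sin\theta-\frac m{\sin\theta}\Big)^2+\frac{\cot^2\theta}4\Big]S^{(-)}=(-\lambda^2+\mu^2a^2\cos^2\theta)S^{(-)}.$$ -/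

import Mathlib

open scoped ComplexConjugate

noncomputable section

namespace KNdS

/-- Parameters of a Kerr–Newman–(anti-)de Sitter spacetime: mass `M`, rotation parameter `a`,
electric charge `e`, cosmological constant `Λ` (of either sign). -/
structure Params where
  M : ℝ
  a : ℝ
  e : ℝ
  Λ : ℝ

/-- Boyer–Lindquist coordinates `x 0 = t`, `x 1 = r`, `x 2 = θ`, `x 3 = φ`. -/
abbrev Point := Fin 4 → ℝ

/-! ### The spacetime -/

def Xi (p : Params) : ℝ := 1 + p.a ^ 2 * p.Λ / 3

def Dθ (p : Params) (θ : ℝ) : ℝ := 1 + p.a ^ 2 * p.Λ / 3 * Real.cos θ ^ 2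

def Dr (p : Params) (r : ℝ) : ℝ :=
  (1 - p.Λ / 3 * r ^ 2) * (r ^ 2 + p.a ^ 2) - 2 * p.M * r + p.e ^ 2

def rhoSq (p : Params) (r θ : ℝ) : ℝ := r ^ 2 + p.a ^ 2 * Real.cos θ ^ 2

/-- `rhoBar = r + i a cos θ`; its complex conjugate is `r - i a cos θ`. -/
def rhoBar (p : Params) (r θ : ℝ) : ℂ := r + Complex.I * p.a * Real.cos θ

/-- The one-form `dt - a sin² θ dφ`. -/
def formT (p : Params) (x : Point) : Fin 4 → ℝ := ![1, 0, 0, -(p.a * Real.sin (x 2) ^ 2)]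

/-- The one-form `a dt - (r² + a²) dφ`. -/
def formPhi (p : Params) (x : Point) : Fin 4 → ℝ := ![p.a, 0, 0, -(x 1 ^ 2 + p.a ^ 2)]

def formR : Fin 4 → ℝ := ![0, 1, 0, 0]

def formTheta : Fin 4 → ℝ := ![0, 0, 1, 0]

/-- The metric tensor, of signature `(+,-,-,-)`. -/
def metric (p : Params) (x : Point) (i j : Fin 4) : ℝ :=
  Dr p (x 1) / (Xi p ^ 2 * rhoSq p (x 1) (x 2)) * (formT p x i * formT p x j)
    - rhoSq p (x 1) (x 2) / Dr p (x 1) * (formR i * formR j)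
    - rhoSq p (x 1) (x 2) / Dθ p (x 2) * (formTheta i * formTheta j)
    - Dθ p (x 2) * Real.sin (x 2) ^ 2 / (Xi p ^ 2 * rhoSq p (x 1) (x 2))
        * (formPhi p x i * formPhi p x j)

/-- The electromagnetic potential one-form. -/
def potential (p : Params) (x : Point) (i : Fin 4) : ℝ :=
  -(p.e * x 1) / (Xi p * (x 1 ^ 2 + p.a ^ 2 * Real.cos (x 2) ^ 2)) * formT p x i

/-! ### The null tetrad and its rotation coefficients -/

/-- The generalised Kinnersley tetrad `(l, n, m, m̄)`, numbered `0, 1, 2, 3`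
(contravariant components). -/
def tetrad (p : Params) (x : Point) : Fin 4 → Fin 4 → ℂ :=
  ![![(((x 1 ^ 2 + p.a ^ 2) * Xi p / Dr p (x 1) : ℝ) : ℂ), 1, 0,
      ((p.a * Xi p / Dr p (x 1) : ℝ) : ℂ)],
    ![((Xi p * (x 1 ^ 2 + p.a ^ 2) / (2 * rhoSq p (x 1) (x 2)) : ℝ) : ℂ),
      ((-Dr p (x 1) / (2 * rhoSq p (x 1) (x 2)) : ℝ) : ℂ), 0,
      ((p.a * Xi p / (2 * rhoSq p (x 1) (x 2)) : ℝ) : ℂ)],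
    fun j => 1 / (rhoBar p (x 1) (x 2) * (√(2 * Dθ p (x 2)) : ℝ)) *
      (![Complex.I * p.a * Xi p * Real.sin (x 2), 0, (Dθ p (x 2) : ℂ),
        Complex.I * Xi p / Real.sin (x 2)] : Fin 4 → ℂ) j,
    fun j => -1 / (conj (rhoBar p (x 1) (x 2)) * (√(2 * Dθ p (x 2)) : ℝ)) *
      (![Complex.I * p.a * Xi p * Real.sin (x 2), 0, -(Dθ p (x 2) : ℂ),
        Complex.I * Xi p / Real.sin (x 2)] : Fin 4 → ℂ) j]

/-- The frame metric of a null tetrad `(l, n, m, m̄)`: `l·n = 1`, `m·m̄ = -1`, all other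
products zero. -/
def nullEta : Matrix (Fin 4) (Fin 4) ℂ := !![0, 1, 0, 0; 1, 0, 0, 0; 0, 0, 0, -1; 0, 0, -1, 0]

/-- The dual co-tetrad: covariant components `e_{(b) i} = g_{ij} e_{(b)}^j`. -/
def coTetrad (p : Params) (b : Fin 4) (x : Point) (i : Fin 4) : ℂ :=
  ∑ j, (metric p x i j : ℂ) * tetrad p x b j

/-- The coordinate partial derivative `∂_j f` at `x`. -/
def pd (j : Fin 4) (f : Point → ℂ) (x : Point) : ℂ :=
  deriv (fun s : ℝ => f (Function.update x j s)) (x j)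

/-- The derivative of `f` along the tetrad vector number `c`. -/
def frameDeriv (p : Params) (c : Fin 4) (f : Point → ℂ) (x : Point) : ℂ :=
  ∑ j, tetrad p x c j * pd j f x

/-- Chandrasekhar's symbols
`λ_{(a)(b)(c)} = e_{(b) i,j} (e_{(a)}^i e_{(c)}^j - e_{(a)}^j e_{(c)}^i)`. -/
def lambdaSymbol (p : Params) (x : Point) (a b c : Fin 4) : ℂ :=
  ∑ i, ∑ j, pd j (fun y => coTetrad p b y i) x *
    (tetrad p x a i * tetrad p x c j - tetrad p x a j * tetrad p x c i)

/-- The Ricci rotation coefficients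
`γ_{(a)(b)(c)} = ½ (λ_{(a)(b)(c)} + λ_{(c)(a)(b)} - λ_{(b)(c)(a)})`. -/
def ricciRot (p : Params) (x : Point) (a b c : Fin 4) : ℂ :=
  (lambdaSymbol p x a b c + lambdaSymbol p x c a b - lambdaSymbol p x b c a) / 2

/-! The twelve Newman–Penrose spin coefficients. With the tetrad numbered from `1`, they are
`κ = γ₃₁₁`, `σ = γ₃₁₃`, `ρ = γ₃₁₄`, `τ = γ₃₁₂`, `ν = γ₂₄₂`, `μ = γ₂₄₃`, `λ = γ₂₄₄`, `π = γ₂₄₁`,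
`ε = ½(γ₂₁₁ + γ₃₄₁)`, `γ = ½(γ₂₁₂ + γ₃₄₂)`, `β = ½(γ₂₁₃ + γ₃₄₃)`, `α = ½(γ₂₁₄ + γ₃₄₄)`. -/

def npκ (p : Params) (x : Point) : ℂ := ricciRot p x 2 0 0
def npσ (p : Params) (x : Point) : ℂ := ricciRot p x 2 0 2
def npρ (p : Params) (x : Point) : ℂ := ricciRot p x 2 0 3
def npτ (p : Params) (x : Point) : ℂ := ricciRot p x 2 0 1
def npν (p : Params) (x : Point) : ℂ := ricciRot p x 1 3 1
def npμ (p : Params) (x : Point) : ℂ := ricciRot p x 1 3 2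
def npLam (p : Params) (x : Point) : ℂ := ricciRot p x 1 3 3
def npπ (p : Params) (x : Point) : ℂ := ricciRot p x 1 3 0
def npε (p : Params) (x : Point) : ℂ := (ricciRot p x 1 0 0 + ricciRot p x 2 3 0) / 2
def npγ (p : Params) (x : Point) : ℂ := (ricciRot p x 1 0 1 + ricciRot p x 2 3 1) / 2
def npβ (p : Params) (x : Point) : ℂ := (ricciRot p x 1 0 2 + ricciRot p x 2 3 2) / 2
def npα (p : Params) (x : Point) : ℂ := (ricciRot p x 1 0 3 + ricciRot p x 2 3 3) / 2

/-! ### Two-spinors and the Dirac equation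

Spinor fields are given by their components in the spin dyad `(o, ι)` of the tetrad,
`l = o ō`, `n = ι ῑ`, `m = o ῑ`, `m̄ = ι ō`. -/

/-- A two-spinor field through its dyad components `P^{(0)}, P^{(1)}`. -/
abbrev Spinor := Fin 2 → Point → ℂ

/-- The number of the tetrad vector `σ_{A Ḃ}`: `00̇ ↦ l`, `01̇ ↦ m`, `10̇ ↦ m̄`, `11̇ ↦ n`. -/
def vecIdx (A B : Fin 2) : Fin 4 := (![![0, 2], ![3, 1]] : Fin 2 → Fin 2 → Fin 4) A B

/-- The antisymmetric spinor `ε^{AB} = ε_{AB}`, with `ε_{01} = 1`. -/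
def eps : Matrix (Fin 2) (Fin 2) ℂ := !![0, 1; -1, 0]

/-- The spin connection `Γ_{AB(c)} = - ½ ε^{ĊḊ} γ_{(AĊ)(BḊ)(c)}` of the Levi-Civita connection
in the dyad. -/
def spinConn (p : Params) (x : Point) (A B : Fin 2) (c : Fin 4) : ℂ :=
  -(1 / 2) * ∑ C, ∑ D, eps C D * ricciRot p x (vecIdx A C) (vecIdx B D) c

/-- Dyad components of the covariant derivative of a spinor along the tetrad vector `c`:
`∇_{(c)} P^C = e_{(c)}(P^C) + ε^{CE} Γ_{ED(c)} P^D`. -/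
def covDeriv (p : Params) (c : Fin 4) (P : Spinor) (C : Fin 2) (x : Point) : ℂ :=
  frameDeriv p c (P C) x + ∑ E, ∑ D, eps C E * spinConn p x E D c * P D x

/-- The tetrad component `e_{(c)}^i A_i` of the potential. -/
def potFrame (p : Params) (c : Fin 4) (x : Point) : ℂ :=
  ∑ i, tetrad p x c i * (potential p x i : ℂ)

/-- `(∇_{AḂ} + i q A_{AḂ}) P^A`. -/
def weylOp (p : Params) (q : ℝ) (P : Spinor) (B : Fin 2) (x : Point) : ℂ :=
  ∑ A, (covDeriv p (vecIdx A B) P A x + Complex.I * q * potFrame p (vecIdx A B) x * P A x)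

/-- The complex conjugate spinor, with components `Q̄^Ċ`. -/
def conjSpinor (Q : Spinor) : Spinor := fun C x => conj (Q C x)

/-- Lowering an index: `Q̄_Ḃ = Q̄^Ċ ε_{ĊḂ}`. -/
def lower (Q : Spinor) (B : Fin 2) (x : Point) : ℂ := ∑ C, Q C x * eps C B

/-- `(∇_{AḂ} + i q A_{AḂ}) P^A + i μ_* Q̄_Ḃ = 0` at `x`, for `Ḃ = 0̇, 1̇`. -/
def HalfDirac (p : Params) (q mass : ℝ) (P Q : Spinor) (x : Point) : Prop :=
  ∀ B : Fin 2, weylOp p q P B x + Complex.I * mass * lower (conjSpinor Q) B x = 0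

/-- The two-spinor form of the Dirac equation at `x` for a particle of charge `q` and mass
`mass = μ_*`. -/
def Dirac (p : Params) (q mass : ℝ) (P Q : Spinor) (x : Point) : Prop :=
  HalfDirac p q mass P Q x ∧ HalfDirac p (-q) mass Q P x

/-! ### Modes and separated equations -/

/-- `e^{i(mφ - ωt)}`. -/
def modePhase (m : ℝ) (ω : ℂ) (x : Point) : ℂ :=
  Complex.exp (Complex.I * (m * x 3 - ω * x 0))

/-- `K = m a - ω (r² + a²)`. -/
def K (p : Params) (m : ℝ) (ω : ℂ) (r : ℝ) : ℂ := m * p.a - ω * (r ^ 2 + p.a ^ 2)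

/-- `H = ω a sin θ - m / sin θ`. -/
def H (p : Params) (m : ℝ) (ω : ℂ) (θ : ℝ) : ℂ := ω * p.a * Real.sin θ - m / Real.sin θ

/-- The ansatz for `P`. -/
def ansatzP (p : Params) (m : ℝ) (ω : ℂ) (Rm Rp Sm Sp : ℝ → ℂ) : Spinor :=
  ![fun x => modePhase m ω x * Sm (x 2) * Rm (x 1) / ((√2 : ℝ) * conj (rhoBar p (x 1) (x 2))),
    fun x => modePhase m ω x * Sp (x 2) * Rp (x 1) / (√(Dr p (x 1)) : ℝ)]

/-- The ansatz for `Q̄`. -/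
def ansatzQbar (p : Params) (m : ℝ) (ω : ℂ) (Rm Rp Sm Sp : ℝ → ℂ) : Spinor :=
  ![fun x => -(modePhase m ω x * Sp (x 2) * Rm (x 1)) / ((√2 : ℝ) * rhoBar p (x 1) (x 2)),
    fun x => modePhase m ω x * Sm (x 2) * Rp (x 1) / (√(Dr p (x 1)) : ℝ)]

/-- The radial equations at `r`, with `R^{(-)} = Rm`, `R^{(+)} = Rp` and separation constant
`lam`. -/
def RadialEqs (p : Params) (q μ m : ℝ) (ω lam : ℂ) (Rm Rp : ℝ → ℂ) (r : ℝ) : Prop :=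
  ((√(Dr p r) : ℝ) : ℂ) *
      (deriv Rm r
        + Xi p * Complex.I * (m * p.a - ω * (r ^ 2 + p.a ^ 2)) / Dr p r * Rm r
        - Complex.I * q * p.e * r * Rm r / Dr p r)
    = (lam + Complex.I * μ * r) * Rp r ∧
  ((√(Dr p r) : ℝ) : ℂ) * deriv Rp r
      - Complex.I * Xi p * (m * p.a - ω * (r ^ 2 + p.a ^ 2)) * Rp r / (√(Dr p r) : ℝ)
      + Complex.I * p.e * q * r * Rp r / (√(Dr p r) : ℝ)
    = (lam - Complex.I * μ * r) * Rm r

/-- `d/dθ (√Δ_θ sin θ)`. -/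
def dSqrtSin (p : Params) (θ : ℝ) : ℝ := deriv (fun s : ℝ => √(Dθ p s) * Real.sin s) θ

/-- The angular equations at `θ`, with `S^{(-)} = Sm`, `S^{(+)} = Sp`. -/
def AngularEqs (p : Params) (μ m : ℝ) (ω lam : ℂ) (Sm Sp : ℝ → ℂ) (θ : ℝ) : Prop :=
  (Dθ p θ : ℂ) / (√(Dθ p θ) : ℝ) * deriv Sp θ
      + Xi p / (√(Dθ p θ) : ℝ) * (-(ω * p.a * Real.sin θ) + m / Real.sin θ) * Sp θ
      + 1 / (2 * Real.sin θ) * dSqrtSin p θ * Sp θ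
    = (-lam + μ * p.a * Real.cos θ) * Sm θ ∧
  (Dθ p θ : ℂ) / (√(Dθ p θ) : ℝ) * deriv Sm θ
      + (ω * p.a * Real.sin θ - m / Real.sin θ) * (Xi p / (√(Dθ p θ) : ℝ)) * Sm θ
      + 1 / (2 * Real.sin θ) * dSqrtSin p θ * Sm θ
    = (lam + μ * p.a * Real.cos θ) * Sp θ

/-! ### The Kerr–Newman equations (`Λ = 0`) -/

/-- `Δ = r² + a² + e² - 2 M r`. -/
def DKN (p : Params) (r : ℝ) : ℝ := r ^ 2 + p.a ^ 2 + p.e ^ 2 - 2 * p.M * r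

/-- The radial equations in Kerr–Newman spacetime. -/
def KNRadialEqs (p : Params) (q μ m : ℝ) (ω lam : ℂ) (Rm Rp : ℝ → ℂ) (r : ℝ) : Prop :=
  ((√(DKN p r) : ℝ) : ℂ) *
      (deriv Rm r
        + (Complex.I * m * p.a - Complex.I * ω * (r ^ 2 + p.a ^ 2)) / DKN p r * Rm r
        - Complex.I * q * p.e * r * Rm r / DKN p r)
    = (lam + Complex.I * μ * r) * Rp r ∧
  ((√(DKN p r) : ℝ) : ℂ) * deriv Rp r
      - Complex.I * (m * p.a - ω * (r ^ 2 + p.a ^ 2)) / (√(DKN p r) : ℝ) * Rp r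
      + Complex.I * p.e * q * r / (√(DKN p r) : ℝ) * Rp r
    = (lam - Complex.I * μ * r) * Rm r

/-- The angular equations in Kerr–Newman spacetime. -/
def KNAngularEqs (p : Params) (μ m : ℝ) (ω lam : ℂ) (Sm Sp : ℝ → ℂ) (θ : ℝ) : Prop :=
  deriv Sp θ
      + (m / Real.sin θ - ω * p.a * Real.sin θ + Real.cos θ / (2 * Real.sin θ)) * Sp θ
    = (-lam + μ * p.a * Real.cos θ) * Sm θ ∧
  deriv Sm θ
      + (ω * p.a * Real.sin θ - m / Real.sin θ + Real.cos θ / (2 * Real.sin θ)) * Sm θ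
    = (lam + μ * p.a * Real.cos θ) * Sp θ

/-- `(r² + a²) ω - m a + e q r`. -/
def KPage (p : Params) (q m : ℝ) (ω : ℂ) (r : ℝ) : ℂ :=
  (r ^ 2 + p.a ^ 2) * ω - m * p.a + p.e * q * r

/-- Page's second-order radial equation for `R = R^{(-)}`. -/
def PageRadial (p : Params) (q μ m : ℝ) (ω lam : ℂ) (R : ℝ → ℂ) (r : ℝ) : Prop :=
  DKN p r * deriv (deriv R) r
    + (r - p.M - Complex.I * μ * DKN p r / (lam + Complex.I * μ * r)) * deriv R r
    + ((KPage p q m ω r ^ 2 + Complex.I * (r - p.M) * KPage p q m ω r) / DKN p r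
        - 2 * Complex.I * ω * r - Complex.I * p.e * q
        - μ * KPage p q m ω r / (lam + Complex.I * μ * r) - μ ^ 2 * r ^ 2 - lam ^ 2) * R r
    = 0

/-- Page's second-order angular equation for `S = S^{(-)}`. -/
def PageAngular (p : Params) (μ m : ℝ) (ω lam : ℂ) (S : ℝ → ℂ) (θ : ℝ) : Prop :=
  (μ * p.a ^ 2 * ω * Real.sin θ ^ 2 * S θ - μ * p.a * m * S θ) / (lam + μ * p.a * Real.cos θ)
    + μ * p.a / 2 * Real.cos θ * S θ / (lam + μ * p.a * Real.cos θ)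
    + μ * p.a * Real.sin θ / (lam + μ * p.a * Real.cos θ) * deriv S θ
    + (deriv (deriv S) θ
        + (ω * p.a * Real.cos θ + m * Real.cos θ / Real.sin θ ^ 2) * S θ
        + Real.cos θ / (2 * Real.sin θ) * deriv S θ
        - 1 / 2 * S θ - 1 / 2 * (Real.cos θ ^ 2 / Real.sin θ ^ 2) * S θ)
    + (-(ω * p.a * Real.sin θ) + m / Real.sin θ) * (ω * p.a * Real.sin θ - m / Real.sin θ) * S θ
    + Real.cos θ / (2 * Real.sin θ) * deriv S θ
    + (1 / (2 * Real.sin θ) * Real.cos θ) ^ 2 * S θ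
    = (-lam ^ 2 + μ ^ 2 * p.a ^ 2 * Real.cos θ ^ 2) * S θ

end KNdS

end

noncomputable section

namespace KNdS

/-! The tetrad is rational in `i`, `a`, `s = sin θ`, `w = √(2Δ_θ)`, `Δ_r`, `Ξ`, `B = ρ̄`, `B' =
ρ̄*`, subject to a few relations: `i² = -1`, `r² + a² = B B' + a² s²`, `B - B' = 2 i a cos θ` and `B
+ B' = 2 r`. So everything about the geometry becomes an identity of rational functions
(`coTetrad_eq_coframe`, `lambdaSymbol_eq_table`, `spinCoefficients`). By stationarity and axial
symmetry only `r`- and `θ`-derivatives of the co-tetrad occur, and the antisymmetry of the rotation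
symbols removes the `r`-derivative of the `r`-components and the `θ`-derivative of the
`θ`-components. The Newman–Penrose form of the Dirac equation is then pure algebra of the spin
connection (`halfDirac_iff`).

The equation separates because the prefactors of the ansatz absorb the connection. The factor
`1/ρ̄*` of `P⁰` cancels `ϱ` in the `l`-derivative and `-τ` in the `m`-derivative, and `1/√Δ_r` in
`P¹` cancels `-γ + μ_NP`. Only `β` and `α - π = -β*` survive, and they give the term with `d(√Δ_θ
sin θ)/dθ`. The potential has no component along `m` or `m̄`, so the charge enters the radial part
only. The mass term acquires a factor `ρ̄` or `ρ̄*`, which is a function of `r` plus a function of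
`θ`. For `Q` one conjugates its equation, because `Q̄` carries the same phase as `P`, also for
complex `ω`. Hence the Dirac equation is four product relations between radial and angular operators
(`dirac_ansatz_iff`).

For the converse, these relations at one radius where the radial pair does not vanish define `λ`,
and a polar angle where the angular pair does not vanish carries it to every radius
(`exists_separation_constant`). Page's equations follow by differentiating the first-order equation
for `R⁽⁻⁾` or `S⁽⁻⁾` and eliminating the other function. -/

lemma conj_rhoBar (p : Params) (r θ : ℝ) :
    conj (rhoBar p r θ) = r - Complex.I * p.a * Real.cos θ := by
  simp [rhoBar, -Complex.ofReal_cos]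
  ring

lemma rhoBar_mul_conj (p : Params) (r θ : ℝ) :
    rhoBar p r θ * conj (rhoBar p r θ) = (rhoSq p r θ : ℂ) := by
  rw [conj_rhoBar, rhoBar, rhoSq]
  push_cast
  linear_combination (-(p.a : ℂ) ^ 2 * Complex.cos θ ^ 2) * Complex.I_sq

lemma rhoBar_ne_zero {p : Params} {r θ : ℝ} (h : rhoSq p r θ ≠ 0) : rhoBar p r θ ≠ 0 := by
  intro h0
  have := rhoBar_mul_conj p r θ
  rw [h0, zero_mul] at this
  exact h (by exact_mod_cast this.symm)

lemma conj_rhoBar_ne_zero {p : Params} {r θ : ℝ} (h : rhoSq p r θ ≠ 0) :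
    conj (rhoBar p r θ) ≠ 0 := by
  simpa using rhoBar_ne_zero h

/-! ### Tetrad and co-tetrad as rational expressions -/

/-- The points at which the tetrad is regular. -/
structure Regular (p : Params) (r θ : ℝ) : Prop where
  xi : Xi p ≠ 0
  dr : Dr p r ≠ 0
  sin : Real.sin θ ≠ 0
  dθ : 0 < Dθ p θ
  rho : rhoSq p r θ ≠ 0

/-- The factor `√(2 Δ_θ)`. -/
def sqrtTwoDθ (p : Params) (θ : ℝ) : ℝ := √(2 * Dθ p θ)

lemma sqrtTwoDθ_sq {p : Params} {θ : ℝ} (h : 0 < Dθ p θ) : sqrtTwoDθ p θ ^ 2 = 2 * Dθ p θ :=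
  Real.sq_sqrt (by positivity)

lemma sqrtTwoDθ_pos {p : Params} {θ : ℝ} (h : 0 < Dθ p θ) : 0 < sqrtTwoDθ p θ :=
  Real.sqrt_pos.2 (by positivity)

/-- A null tetrad `(l, n, m, m̄)` in terms of algebraically independent quantities:
`i` is the imaginary unit, `A = r² + a²`, `w = √(2 Δ_θ)`, `B = r + i a cos θ` and `B'` its
conjugate. -/
def frame {F : Type*} [Field F] (i a s w D X A B B' : F) : Fin 4 → Fin 4 → F :=
  ![![A * X / D, 1, 0, a * X / D],
    ![A * X / (2 * (B * B')), -D / (2 * (B * B')), 0, a * X / (2 * (B * B'))],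
    ![i * a * s * X / (B * w), 0, w / (2 * B), i * X / (B * w * s)],
    ![-(i * a * s * X) / (B' * w), 0, w / (2 * B'), -(i * X) / (B' * w * s)]]

/-- The co-tetrad of `frame`. -/
def coframe {F : Type*} [Field F] (i a s w D X A B B' : F) : Fin 4 → Fin 4 → F :=
  ![![1 / X, -(B * B') / D, 0, -(a * s ^ 2) / X],
    ![D / (2 * (B * B') * X), 1 / 2, 0, -(a * s ^ 2 * D) / (2 * (B * B') * X)],
    ![i * a * (w * s) / (2 * X * B), 0, -(B' / w), -(i * A * (w * s)) / (2 * X * B)],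
    ![-(i * a * (w * s)) / (2 * X * B'), 0, -(B / w), i * A * (w * s) / (2 * X * B')]]

/-- Substituting `Δ_θ = w² / 2` turns `Δ_θ / w` into `w / 2`, so that the radical `w` is the only
trace of `Δ_θ`. -/
lemma tetrad_eq_frame {p : Params} {x : Point} (h : Regular p (x 1) (x 2)) :
    tetrad p x = frame Complex.I p.a (Real.sin (x 2)) (sqrtTwoDθ p (x 2)) (Dr p (x 1)) (Xi p)
      ((x 1 : ℂ) ^ 2 + (p.a : ℂ) ^ 2) (rhoBar p (x 1) (x 2)) (conj (rhoBar p (x 1) (x 2))) := by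
  have hB := rhoBar_ne_zero h.rho
  have hB' := conj_rhoBar_ne_zero h.rho
  have hw : (sqrtTwoDθ p (x 2) : ℂ) ≠ 0 := by exact_mod_cast (sqrtTwoDθ_pos h.dθ).ne'
  have hs : (Real.sin (x 2) : ℂ) ≠ 0 := by exact_mod_cast h.sin
  have hD : (Dr p (x 1) : ℂ) ≠ 0 := by exact_mod_cast h.dr
  have hρ : (rhoSq p (x 1) (x 2) : ℂ) ≠ 0 := by exact_mod_cast h.rho
  have hw2 : (Dθ p (x 2) : ℂ) = (sqrtTwoDθ p (x 2) : ℂ) ^ 2 / 2 := by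
    have := sqrtTwoDθ_sq h.dθ
    rw [← Complex.ofReal_pow, this]; push_cast; ring
  funext b j
  have e : √(2 * Dθ p (x 2)) = sqrtTwoDθ p (x 2) := rfl
  fin_cases b <;> fin_cases j <;>
    simp [tetrad, frame, rhoBar_mul_conj, e, hw2, -Complex.ofReal_sin] <;> field_simp

/-- The identity `ρ² + a² sin² θ = r² + a²`. -/
lemma rhoSq_add (p : Params) (r θ : ℝ) :
    (r : ℂ) ^ 2 + (p.a : ℂ) ^ 2 =
      rhoBar p r θ * conj (rhoBar p r θ) + (p.a : ℂ) ^ 2 * (Real.sin θ : ℂ) ^ 2 := by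
  rw [rhoBar_mul_conj]
  have := Real.sin_sq_add_cos_sq θ
  rw [rhoSq]
  norm_cast
  linear_combination (-p.a ^ 2) * this

/-- `a dt - (r² + a²) dφ` annihilates `l` and `n`, while `dt - a sin² θ dφ` annihilates `m` and
`m̄`; the remaining pairings produce `r² + a² - a² sin² θ = ρ²`, which cancels the denominators of
the metric. -/
lemma coTetrad_eq_coframe {p : Params} {x : Point} (h : Regular p (x 1) (x 2)) (b i : Fin 4) :
    coTetrad p b x i = coframe Complex.I p.a (Real.sin (x 2)) (sqrtTwoDθ p (x 2)) (Dr p (x 1))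
      (Xi p) ((x 1 : ℂ) ^ 2 + (p.a : ℂ) ^ 2) (rhoBar p (x 1) (x 2))
      (conj (rhoBar p (x 1) (x 2))) b i := by
  have hB := rhoBar_ne_zero h.rho
  have hB' := conj_rhoBar_ne_zero h.rho
  have hw : (sqrtTwoDθ p (x 2) : ℂ) ≠ 0 := by exact_mod_cast (sqrtTwoDθ_pos h.dθ).ne'
  have hs : (Real.sin (x 2) : ℂ) ≠ 0 := by exact_mod_cast h.sin
  have hD : (Dr p (x 1) : ℂ) ≠ 0 := by exact_mod_cast h.dr
  have hX : (Xi p : ℂ) ≠ 0 := by exact_mod_cast h.xi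
  have hw2 : (Dθ p (x 2) : ℂ) = (sqrtTwoDθ p (x 2) : ℂ) ^ 2 / 2 := by
    have := sqrtTwoDθ_sq h.dθ
    rw [← Complex.ofReal_pow, this]; push_cast; ring
  have hA := rhoSq_add p (x 1) (x 2)
  have hI := Complex.I_sq
  rw [coTetrad, tetrad_eq_frame h]
  simp only [Fin.sum_univ_four, metric]
  push_cast
  rw [← rhoBar_mul_conj, hw2]
  simp only [← Complex.ofReal_sin]
  -- This component contains `r² + a²`, so it is recorded separately and rewritten through `B B' +
  -- a² s²` together with the goal.
  have hφ : (formPhi p x 3 : ℂ) = -((x 1 : ℂ) ^ 2 + (p.a : ℂ) ^ 2) := by simp [formPhi]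
  rw [hA] at hφ ⊢
  generalize rhoBar p (x 1) (x 2) = B at *
  generalize conj B = B' at *
  generalize (sqrtTwoDθ p (x 2) : ℂ) = w at *
  generalize (Dr p (x 1) : ℂ) = D at *
  generalize (Xi p : ℂ) = X at *
  fin_cases b <;> fin_cases i <;>
    simp [frame, coframe, formT, formR, formTheta, hφ, -Complex.ofReal_sin] <;>
    simp [formPhi, -Complex.ofReal_sin] <;>
    generalize (Real.sin (x 2) : ℂ) = s at * <;> generalize (p.a : ℂ) = a at * <;>
    generalize Complex.I = I at * <;>
    field_simp <;> ring_nf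

/-! ### Derivatives of the co-tetrad -/

lemma tetrad_congr (p : Params) {x y : Point} (h1 : y 1 = x 1) (h2 : y 2 = x 2) :
    tetrad p y = tetrad p x := by
  simp [tetrad, h1, h2]

/-- Stationarity and axial symmetry: this is what kills the `t`- and `φ`-derivatives. -/
lemma coTetrad_congr (p : Params) {x y : Point} (h1 : y 1 = x 1) (h2 : y 2 = x 2)
    (b i : Fin 4) : coTetrad p b y i = coTetrad p b x i := by
  simp [coTetrad, metric, formT, formPhi, tetrad_congr p h1 h2, h1, h2]

lemma pd_zero_coTetrad (p : Params) (x : Point) (b i : Fin 4) :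
    pd 0 (fun y => coTetrad p b y i) x = 0 := by
  have : ∀ s, coTetrad p b (Function.update x 0 s) i = coTetrad p b x i := fun s =>
    coTetrad_congr p (by simp) (by simp) b i
  simp [pd, this]

lemma pd_three_coTetrad (p : Params) (x : Point) (b i : Fin 4) :
    pd 3 (fun y => coTetrad p b y i) x = 0 := by
  have : ∀ s, coTetrad p b (Function.update x 3 s) i = coTetrad p b x i := fun s =>
    coTetrad_congr p (by simp) (by simp) b i
  simp [pd, this]

lemma differentiable_Dr (p : Params) : Differentiable ℝ (Dr p) := by
  unfold Dr; fun_prop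

lemma differentiable_Dθ (p : Params) : Differentiable ℝ (Dθ p) := by
  unfold Dθ; fun_prop

/-- Regularity is an open condition, so the closed formula for the co-tetrad holds near the point
and may be differentiated there. -/
lemma Regular.eventually_r {p : Params} {r θ : ℝ} (h : Regular p r θ) :
    ∀ᶠ s in nhds r, Regular p s θ := by
  have c2 : Continuous fun s => rhoSq p s θ := by unfold rhoSq; fun_prop
  filter_upwards [(differentiable_Dr p).continuous.continuousAt.eventually_ne h.dr,
    c2.continuousAt.eventually_ne h.rho] with s h1 h2
  exact ⟨h.xi, h1, h.sin, h.dθ, h2⟩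

lemma Regular.eventually_θ {p : Params} {r θ : ℝ} (h : Regular p r θ) :
    ∀ᶠ s in nhds θ, Regular p r s := by
  have c2 : Continuous fun s => rhoSq p r s := by unfold rhoSq; fun_prop
  filter_upwards [Real.continuous_sin.continuousAt.eventually_ne h.sin,
    (differentiable_Dθ p).continuous.continuousAt.eventually (lt_mem_nhds h.dθ),
    c2.continuousAt.eventually_ne h.rho] with s h1 h2 h3
  exact ⟨h.xi, h.dr, h1, h2, h3⟩

lemma sqrtTwoDθ_eq (p : Params) (θ : ℝ) : sqrtTwoDθ p θ = √2 * √(Dθ p θ) := by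
  simp [sqrtTwoDθ]

/-- In the components whose `θ`-derivative matters, `w` occurs only in the product `w sin θ`; its
derivative is the quantity that appears in `β`. -/
lemma hasDerivAt_sqrtTwoDθ_mul_sin {p : Params} {θ : ℝ} (h : 0 < Dθ p θ) :
    HasDerivAt (fun s => sqrtTwoDθ p s * Real.sin s) (√2 * dSqrtSin p θ) θ := by
  have : DifferentiableAt ℝ (fun s : ℝ => √(Dθ p s) * Real.sin s) θ :=
    (((differentiable_Dθ p) θ).sqrt h.ne').mul Real.differentiable_sin.differentiableAt
  have := this.hasDerivAt.const_mul (√2)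
  simp only [sqrtTwoDθ_eq, mul_assoc]
  exact this

lemma hasDerivAt_rhoBar_r (p : Params) (r θ : ℝ) :
    HasDerivAt (fun s => rhoBar p s θ) 1 r := by
  unfold rhoBar
  exact (Complex.ofRealCLM.hasDerivAt (x := r)).add_const _

lemma hasDerivAt_rhoBar_θ (p : Params) (r θ : ℝ) :
    HasDerivAt (fun s => rhoBar p r s) (-(Complex.I * p.a * Real.sin θ)) θ := by
  unfold rhoBar
  have := ((Real.hasDerivAt_cos θ).ofReal_comp.const_mul (Complex.I * p.a)).const_add (r : ℂ)
  exact this.congr_deriv (by push_cast; ring)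

lemma hasDerivAt_conj_rhoBar_r (p : Params) (r θ : ℝ) :
    HasDerivAt (fun s => conj (rhoBar p s θ)) 1 r := by
  simpa using (hasDerivAt_rhoBar_r p r θ).star

lemma hasDerivAt_conj_rhoBar_θ (p : Params) (r θ : ℝ) :
    HasDerivAt (fun s => conj (rhoBar p r s)) (Complex.I * p.a * Real.sin θ) θ := by
  simpa [← Complex.ofReal_sin] using (hasDerivAt_rhoBar_θ p r θ).star

/-- The `r`-derivative of `coframe` (up to the irrelevant `r`-components). Here `D₁` is the
derivative of `Δ_r`. -/
def coframeR {F : Type*} [Field F] (i r a s w D D₁ X A B B' : F) : Fin 4 → Fin 4 → F :=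
  ![![0, 0, 0, 0],
    ![(D₁ * (B * B') - D * (B + B')) / (2 * (B * B') ^ 2 * X), 0, 0,
      -(a * s ^ 2) * (D₁ * (B * B') - D * (B + B')) / (2 * (B * B') ^ 2 * X)],
    ![-(i * a * (w * s)) / (2 * X * B ^ 2), 0, -(1 / w),
      -(i * (w * s) * (2 * r * B - A)) / (2 * X * B ^ 2)],
    ![i * a * (w * s) / (2 * X * B' ^ 2), 0, -(1 / w),
      i * (w * s) * (2 * r * B' - A) / (2 * X * B' ^ 2)]]

/-- The `θ`-derivative of `coframe` (up to the irrelevant `θ`-components). Here `W` is the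
derivative of `√(2 Δ_θ) sin θ` and `c = cos θ`. -/
def coframeθ {F : Type*} [Field F] (i a s c w W D X A B B' : F) : Fin 4 → Fin 4 → F :=
  ![![0, 2 * a ^ 2 * c * s / D, 0, -(2 * a * s * c) / X],
    ![D * a ^ 2 * c * s / ((B * B') ^ 2 * X), 0, 0, -(a * s * c * D * A) / ((B * B') ^ 2 * X)],
    ![i * a * (W * B + i * a * s * (w * s)) / (2 * X * B ^ 2), 0, 0,
      -(i * A * (W * B + i * a * s * (w * s))) / (2 * X * B ^ 2)],
    ![-(i * a * (W * B' - i * a * s * (w * s))) / (2 * X * B' ^ 2), 0, 0,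
      i * A * (W * B' - i * a * s * (w * s)) / (2 * X * B' ^ 2)]]

lemma pd_one_coTetrad {p : Params} {x : Point} (h : Regular p (x 1) (x 2)) (b i : Fin 4)
    (hi : i ≠ 1) :
    pd 1 (fun y => coTetrad p b y i) x = coframeR Complex.I (x 1) p.a (Real.sin (x 2))
      (sqrtTwoDθ p (x 2)) (Dr p (x 1)) (deriv (Dr p) (x 1) : ℝ) (Xi p)
      ((x 1 : ℂ) ^ 2 + (p.a : ℂ) ^ 2) (rhoBar p (x 1) (x 2))
      (conj (rhoBar p (x 1) (x 2))) b i := by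
  have hB := rhoBar_ne_zero h.rho
  have hB' := conj_rhoBar_ne_zero h.rho
  have hw : (sqrtTwoDθ p (x 2) : ℂ) ≠ 0 := by exact_mod_cast (sqrtTwoDθ_pos h.dθ).ne'
  have hX : (Xi p : ℂ) ≠ 0 := by exact_mod_cast h.xi
  have ev : (fun s : ℝ => coTetrad p b (Function.update x 1 s) i) =ᶠ[nhds (x 1)] fun s : ℝ =>
      coframe Complex.I p.a (Real.sin (x 2)) (sqrtTwoDθ p (x 2)) (Dr p s)
      (Xi p) ((s : ℂ) ^ 2 + (p.a : ℂ) ^ 2) (rhoBar p s (x 2)) (conj (rhoBar p s (x 2))) b i := by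
    filter_upwards [h.eventually_r] with s hs
    have := coTetrad_eq_coframe (x := Function.update x 1 s) (p := p) (by simpa using hs) b i
    simpa using this
  rw [pd, ev.deriv_eq]
  have dB := hasDerivAt_rhoBar_r p (x 1) (x 2)
  have dB' := hasDerivAt_conj_rhoBar_r p (x 1) (x 2)
  have dD := ((differentiable_Dr p) (x 1)).hasDerivAt.ofReal_comp
  have dr := Complex.ofRealCLM.hasDerivAt (x := x 1)
  have dA : HasDerivAt (fun s : ℝ => (s : ℂ) ^ 2 + (p.a : ℂ) ^ 2) (2 * x 1) (x 1) :=
    ((dr.pow 2).add_const _).congr_deriv (by simp)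
  have den := ((dB.mul dB').const_mul 2).mul_const (Xi p : ℂ)
  have denB := dB.const_mul (2 * (Xi p : ℂ))
  have denB' := dB'.const_mul (2 * (Xi p : ℂ))
  have hden : 2 * (rhoBar p (x 1) (x 2) * conj (rhoBar p (x 1) (x 2))) * (Xi p : ℂ) ≠ 0 := by
    simp [*]
  have hdenB : 2 * (Xi p : ℂ) * rhoBar p (x 1) (x 2) ≠ 0 := by simp [*]
  have hdenB' : 2 * (Xi p : ℂ) * conj (rhoBar p (x 1) (x 2)) ≠ 0 := by simp [*]
  set s : ℂ := (Real.sin (x 2) : ℂ)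
  set w : ℂ := (sqrtTwoDθ p (x 2) : ℂ)
  set a : ℂ := (p.a : ℂ)
  -- The constant entries, and the excluded one, are disposed of at once; eight quotients depending
  -- on `r` remain.
  fin_cases b <;> fin_cases i <;> first | exact absurd rfl hi | exact deriv_const _ _ | skip
  · refine ((dD.div den hden).congr_deriv ?_).deriv
    simp only [coframeR, Fin.mk_zero, Fin.mk_one, Matrix.cons_val, Pi.mul_apply]
    field_simp
    ring
  · refine (((dD.const_mul (a * s ^ 2)).neg.div den hden).congr_deriv ?_).deriv
    simp only [coframeR, Fin.mk_one, Fin.reduceFinMk, Matrix.cons_val, Pi.mul_apply, Pi.neg_apply]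
    field_simp
    ring
  · refine (((hasDerivAt_const (x 1) (Complex.I * a * (w * s))).div denB hdenB).congr_deriv
      ?_).deriv
    simp only [coframeR, Fin.mk_zero, Fin.reduceFinMk, Matrix.cons_val]
    field_simp
    ring
  · refine ((dB'.div_const w).neg.congr_deriv ?_).deriv
    simp only [coframeR, Fin.reduceFinMk, Matrix.cons_val]
  · refine ((((dA.const_mul Complex.I).mul_const (w * s)).neg.div denB hdenB).congr_deriv ?_).deriv
    simp only [coframeR, Fin.reduceFinMk, Matrix.cons_val, Pi.neg_apply]
    field_simp
    ring
  · refine (((hasDerivAt_const (x 1) (-(Complex.I * a * (w * s)))).div denB' hdenB').congr_deriv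
      ?_).deriv
    simp only [coframeR, Fin.mk_zero, Fin.reduceFinMk, Matrix.cons_val]
    field_simp
    ring
  · refine ((dB.div_const w).neg.congr_deriv ?_).deriv
    simp only [coframeR, Fin.reduceFinMk, Matrix.cons_val]
  · refine ((((dA.const_mul Complex.I).mul_const (w * s)).div denB' hdenB').congr_deriv ?_).deriv
    simp only [coframeR, Fin.reduceFinMk, Matrix.cons_val]
    field_simp

lemma pd_two_coTetrad {p : Params} {x : Point} (h : Regular p (x 1) (x 2)) (b i : Fin 4)
    (hi : i ≠ 2) :
    pd 2 (fun y => coTetrad p b y i) x = coframeθ Complex.I p.a (Real.sin (x 2))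
      (Real.cos (x 2)) (sqrtTwoDθ p (x 2)) (√2 * dSqrtSin p (x 2) : ℝ) (Dr p (x 1)) (Xi p)
      ((x 1 : ℂ) ^ 2 + (p.a : ℂ) ^ 2) (rhoBar p (x 1) (x 2))
      (conj (rhoBar p (x 1) (x 2))) b i := by
  have hB := rhoBar_ne_zero h.rho
  have hB' := conj_rhoBar_ne_zero h.rho
  have hX : (Xi p : ℂ) ≠ 0 := by exact_mod_cast h.xi
  have hD : (Dr p (x 1) : ℂ) ≠ 0 := by exact_mod_cast h.dr
  have ev : (fun s : ℝ => coTetrad p b (Function.update x 2 s) i) =ᶠ[nhds (x 2)] fun s : ℝ =>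
      coframe Complex.I p.a (Real.sin s) (sqrtTwoDθ p s) (Dr p (x 1))
      (Xi p) ((x 1 : ℂ) ^ 2 + (p.a : ℂ) ^ 2) (rhoBar p (x 1) s) (conj (rhoBar p (x 1) s)) b i := by
    filter_upwards [h.eventually_θ] with s hs
    have := coTetrad_eq_coframe (x := Function.update x 2 s) (p := p) (by simpa using hs) b i
    simpa using this
  rw [pd, ev.deriv_eq]
  have hA := rhoSq_add p (x 1) (x 2)
  have dB := hasDerivAt_rhoBar_θ p (x 1) (x 2)
  have dB' := hasDerivAt_conj_rhoBar_θ p (x 1) (x 2)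
  have ds : HasDerivAt (fun s : ℝ => (Real.sin s : ℂ) ^ 2)
      (2 * Real.sin (x 2) * Real.cos (x 2)) (x 2) :=
    ((Real.hasDerivAt_sin (x 2)).ofReal_comp.pow 2).congr_deriv (by simp)
  have dW := (hasDerivAt_sqrtTwoDθ_mul_sin h.dθ).ofReal_comp
  simp only [Complex.ofReal_mul (sqrtTwoDθ p _)] at dW
  have den := ((dB.mul dB').const_mul 2).mul_const (Xi p : ℂ)
  have denB := dB.const_mul (2 * (Xi p : ℂ))
  have denB' := dB'.const_mul (2 * (Xi p : ℂ))
  have hden : 2 * (rhoBar p (x 1) (x 2) * conj (rhoBar p (x 1) (x 2))) * (Xi p : ℂ) ≠ 0 := by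
    simp [*]
  have hdenB : 2 * (Xi p : ℂ) * rhoBar p (x 1) (x 2) ≠ 0 := by simp [*]
  have hdenB' : 2 * (Xi p : ℂ) * conj (rhoBar p (x 1) (x 2)) ≠ 0 := by simp [*]
  -- The product rule gives `∂_θ ρ² = i a sin θ (ρ̄ - ρ̄*)`; this identity and `i² = -1` bring it to
  -- `-2 a² sin θ cos θ`.
  have hBB : rhoBar p (x 1) (x 2) - conj (rhoBar p (x 1) (x 2)) =
      2 * Complex.I * p.a * Real.cos (x 2) := by
    rw [conj_rhoBar, rhoBar]; ring
  have hI := Complex.I_sq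
  fin_cases b <;> fin_cases i <;> first | exact absurd rfl hi | exact deriv_const _ _ | skip
  · refine (((dB.mul dB').neg.div_const (Dr p (x 1) : ℂ)).congr_deriv ?_).deriv
    simp only [coframeθ, Fin.mk_zero, Fin.mk_one, Matrix.cons_val]
    field_simp
    linear_combination -(p.a * Real.sin (x 2) * Complex.I) * hBB -
      2 * p.a ^ 2 * Real.cos (x 2) * Real.sin (x 2) * hI
  · refine (((ds.const_mul (p.a : ℂ)).neg.div_const (Xi p : ℂ)).congr_deriv ?_).deriv
    simp only [coframeθ, Fin.mk_zero, Fin.reduceFinMk, Matrix.cons_val]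
    field_simp
  · refine (((hasDerivAt_const (x 2) (Dr p (x 1) : ℂ)).div den hden).congr_deriv ?_).deriv
    simp only [coframeθ, Fin.mk_zero, Fin.mk_one, Matrix.cons_val, Pi.mul_apply]
    field_simp
    linear_combination -(Dr p (x 1) * p.a * Real.sin (x 2) * Complex.I) * hBB -
      2 * Dr p (x 1) * p.a ^ 2 * Real.cos (x 2) * Real.sin (x 2) * hI
  · refine ((((ds.const_mul (p.a : ℂ)).mul_const (Dr p (x 1) : ℂ)).neg.div den hden).congr_deriv
      ?_).deriv
    simp only [coframeθ, Fin.mk_one, Fin.reduceFinMk, Matrix.cons_val, Pi.mul_apply, Pi.neg_apply]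
    rw [hA]
    field_simp
    linear_combination (p.a ^ 2 * Real.sin (x 2) ^ 3 * Complex.I) * hBB +
      2 * p.a ^ 3 * Real.sin (x 2) ^ 3 * Real.cos (x 2) * hI
  · refine (((dW.const_mul (Complex.I * p.a)).div denB hdenB).congr_deriv ?_).deriv
    simp only [coframeθ, Fin.mk_zero, Fin.reduceFinMk, Matrix.cons_val]
    field_simp
    ring
  · refine (((dW.const_mul (Complex.I * ((x 1 : ℂ) ^ 2 + (p.a : ℂ) ^ 2))).neg.div denB hdenB).congr_deriv
      ?_).deriv
    simp only [coframeθ, Fin.reduceFinMk, Matrix.cons_val, Pi.neg_apply]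
    field_simp
    ring
  · refine (((dW.const_mul (Complex.I * p.a)).neg.div denB' hdenB').congr_deriv ?_).deriv
    simp only [coframeθ, Fin.mk_zero, Fin.reduceFinMk, Matrix.cons_val, Pi.neg_apply]
    field_simp
    ring
  · refine (((dW.const_mul (Complex.I * ((x 1 : ℂ) ^ 2 + (p.a : ℂ) ^ 2))).div denB' hdenB').congr_deriv
      ?_).deriv
    simp only [coframeθ, Fin.reduceFinMk, Matrix.cons_val]
    field_simp

/-! ### Rotation symbols and spin coefficients -/

lemma lambdaSymbol_swap (p : Params) (x : Point) (a b c : Fin 4) :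
    lambdaSymbol p x c b a = -lambdaSymbol p x a b c := by
  simp only [lambdaSymbol, ← Finset.sum_neg_distrib]
  refine Finset.sum_congr rfl fun i _ => Finset.sum_congr rfl fun j _ => ?_
  ring

lemma lambdaSymbol_self (p : Params) (x : Point) (a b : Fin 4) :
    lambdaSymbol p x a b a = 0 := by
  have := lambdaSymbol_swap p x a b a
  linear_combination this / 2

/-- Metric compatibility in a frame with constant products. Algebraically, exchanging `a` and `b`
permutes the three symbols and reverses their outer indices. -/
lemma ricciRot_swap (p : Params) (x : Point) (a b c : Fin 4) :
    ricciRot p x b a c = -ricciRot p x a b c := by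
  rw [ricciRot, ricciRot, lambdaSymbol_swap p x a c b, lambdaSymbol_swap p x a b c,
    lambdaSymbol_swap p x c a b]
  ring

lemma ricciRot_self (p : Params) (x : Point) (a c : Fin 4) : ricciRot p x a a c = 0 := by
  have := ricciRot_swap p x a a c
  linear_combination this / 2

/-- The rotation symbols in terms of the `r`- and `θ`-derivatives of the co-tetrad. -/
lemma lambdaSymbol_eq (p : Params) (x : Point) (a b c : Fin 4) (R T : Fin 4 → ℂ)
    (hR : ∀ i, i ≠ 1 → pd 1 (fun y => coTetrad p b y i) x = R i)
    (hT : ∀ i, i ≠ 2 → pd 2 (fun y => coTetrad p b y i) x = T i) :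
    lambdaSymbol p x a b c =
      R 0 * (tetrad p x a 0 * tetrad p x c 1 - tetrad p x a 1 * tetrad p x c 0) +
      R 2 * (tetrad p x a 2 * tetrad p x c 1 - tetrad p x a 1 * tetrad p x c 2) +
      R 3 * (tetrad p x a 3 * tetrad p x c 1 - tetrad p x a 1 * tetrad p x c 3) +
      T 0 * (tetrad p x a 0 * tetrad p x c 2 - tetrad p x a 2 * tetrad p x c 0) +
      T 1 * (tetrad p x a 1 * tetrad p x c 2 - tetrad p x a 2 * tetrad p x c 1) +
      T 3 * (tetrad p x a 3 * tetrad p x c 2 - tetrad p x a 2 * tetrad p x c 3) := by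
  -- The terms with `i = j` have a vanishing bracket, which is why neither `R 1` nor `T 2` is
  -- needed.
  simp only [lambdaSymbol, Fin.sum_univ_four, pd_zero_coTetrad, pd_three_coTetrad,
    hR 0 (by decide), hR 2 (by decide), hR 3 (by decide), hT 0 (by decide), hT 1 (by decide),
    hT 3 (by decide)]
  ring

/-- The rotation symbols `λ_{(a)(b)(c)}` of the tetrad `frame`, indexed by `a`, `c`, `b`, for
`a < c`. -/
def rotationTable {F : Type*} [Field F] (i a s c w W D D₁ B B' : F) :
    Fin 4 → Fin 4 → Fin 4 → F :=
  ![![0,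
      ![0, -(D₁ * (B * B') - D * (B + B')) / (2 * (B * B') ^ 2),
        i * a * s * w * (B + B') / (2 * (B * B') * B),
        -(i * a * s * w * (B + B')) / (2 * (B * B') * B')],
      ![0, 0, 0, 1 / B], ![0, 0, 1 / B', 0]],
    ![0, 0,
      ![-(a ^ 2 * c * s * w) / (B * B' * B), 0, 0, -D / (2 * (B * B') * B)],
      ![-(a ^ 2 * c * s * w) / (B * B' * B'), 0, -D / (2 * (B * B') * B'), 0]],
    ![0, 0, 0,
      ![-(2 * i * a * c) / (B * B'), -(i * a * c * D) / (B * B') ^ 2,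
        (W * B + i * a * s * (w * s)) / (2 * B ^ 2 * s),
        -(W * B' - i * a * s * (w * s)) / (2 * B' ^ 2 * s)]],
    0]

-- `Ξ` cancels between the legs and the covectors. Once `r` and `r² + a²` are expressed through `B`,
-- `B'`, `a` and `s`, the only relation left to use is `i² = -1`; `cos θ`, `∂_r Δ_r` and the
-- derivative of `w sin θ` stay free. By antisymmetry `a < c` suffices.
set_option maxHeartbeats 1000000 in
lemma lambdaSymbol_eq_table {p : Params} {x : Point} (h : Regular p (x 1) (x 2)) (a b c : Fin 4)
    (hac : a < c) :
    lambdaSymbol p x a b c = rotationTable Complex.I p.a (Real.sin (x 2)) (Real.cos (x 2))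
      (sqrtTwoDθ p (x 2)) (√2 * dSqrtSin p (x 2) : ℝ) (Dr p (x 1)) (deriv (Dr p) (x 1) : ℝ)
      (rhoBar p (x 1) (x 2)) (conj (rhoBar p (x 1) (x 2))) a c b := by
  rw [lambdaSymbol_eq p x a b c _ _ (fun i hi => pd_one_coTetrad h b i hi)
    (fun i hi => pd_two_coTetrad h b i hi), tetrad_eq_frame h]
  have hB := rhoBar_ne_zero h.rho
  have hB' := conj_rhoBar_ne_zero h.rho
  have hw : (sqrtTwoDθ p (x 2) : ℂ) ≠ 0 := by exact_mod_cast (sqrtTwoDθ_pos h.dθ).ne'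
  have hs : (Real.sin (x 2) : ℂ) ≠ 0 := by exact_mod_cast h.sin
  have hD : (Dr p (x 1) : ℂ) ≠ 0 := by exact_mod_cast h.dr
  have hX : (Xi p : ℂ) ≠ 0 := by exact_mod_cast h.xi
  have hA := rhoSq_add p (x 1) (x 2)
  have hr : (x 1 : ℂ) = (rhoBar p (x 1) (x 2) + conj (rhoBar p (x 1) (x 2))) / 2 := by
    rw [conj_rhoBar, rhoBar]; ring
  have hI := Complex.I_sq
  rw [hA, hr]
  clear hA hr
  generalize rhoBar p (x 1) (x 2) = B at *
  generalize conj B = B' at *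
  generalize (sqrtTwoDθ p (x 2) : ℂ) = w at *
  generalize (Dr p (x 1) : ℂ) = D at *
  generalize (Xi p : ℂ) = X at *
  generalize ((√2 * dSqrtSin p (x 2) : ℝ) : ℂ) = W at *
  generalize ((deriv (Dr p) (x 1) : ℝ) : ℂ) = D₁ at *
  generalize (Real.sin (x 2) : ℂ) = s at *
  generalize (Real.cos (x 2) : ℂ) = k at *
  generalize (p.a : ℂ) = a' at *
  generalize Complex.I = i at *
  fin_cases a <;> fin_cases c <;> first | exact absurd hac (by decide) | skip
  all_goals fin_cases b
  all_goals simp only [frame, coframeR, coframeθ, rotationTable, Fin.mk_zero, Fin.mk_one,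
    Fin.reduceFinMk,
    Matrix.cons_val]
  all_goals simp only [mul_zero, zero_mul, sub_zero, zero_sub, add_zero, zero_add, one_mul]
  all_goals field_simp
  all_goals try ring1
  all_goals try (clear * - hI; grind)

lemma tetrad_null {p : Params} {x : Point} (h : Regular p (x 1) (x 2)) (b c : Fin 4) :
    ∑ i, ∑ j, (metric p x i j : ℂ) * tetrad p x b i * tetrad p x c j = nullEta b c := by
  -- Lowering one index first reduces the inner products to contractions of `frame` with `coframe`.
  have e : ∀ i, ∑ j, (metric p x i j : ℂ) * tetrad p x b i * tetrad p x c j =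
      tetrad p x b i * coTetrad p c x i := fun i => by
    rw [coTetrad, Finset.mul_sum]
    exact Finset.sum_congr rfl fun j _ => by ring
  simp only [e, Fin.sum_univ_four, coTetrad_eq_coframe h]
  rw [tetrad_eq_frame h]
  have hB := rhoBar_ne_zero h.rho
  have hB' := conj_rhoBar_ne_zero h.rho
  have hw : (sqrtTwoDθ p (x 2) : ℂ) ≠ 0 := by exact_mod_cast (sqrtTwoDθ_pos h.dθ).ne'
  have hs : (Real.sin (x 2) : ℂ) ≠ 0 := by exact_mod_cast h.sin
  have hD : (Dr p (x 1) : ℂ) ≠ 0 := by exact_mod_cast h.dr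
  have hX : (Xi p : ℂ) ≠ 0 := by exact_mod_cast h.xi
  have hI := Complex.I_sq
  rw [rhoSq_add p (x 1) (x 2)]
  generalize rhoBar p (x 1) (x 2) = B at *
  generalize conj B = B' at *
  generalize (sqrtTwoDθ p (x 2) : ℂ) = w at *
  generalize (Dr p (x 1) : ℂ) = D at *
  generalize (Xi p : ℂ) = X at *
  generalize (Real.sin (x 2) : ℂ) = s at *
  generalize (p.a : ℂ) = a' at *
  generalize Complex.I = i at *
  fin_cases b <;> fin_cases c
  all_goals simp only [frame, coframe, nullEta, Fin.mk_zero, Fin.mk_one, Fin.reduceFinMk,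
    Matrix.cons_val, Matrix.of_apply, mul_zero, zero_mul, add_zero,
    one_mul]
  all_goals try field_simp
  all_goals try ring1
  all_goals try (clear * - hI; grind)

/-- Each Ricci coefficient combines three table entries, and `B - B' = 2 i a cos θ` merges them: for
`ϱ`, the entry `-2 i a cos θ / (B B')` becomes `1/B - 1/B'` and combines with `-1/B' - 1/B`. The
letters are tied to their values by hypotheses so that both short and explicit forms can be used. -/
lemma spinCoefficients {p : Params} {x : Point} (h : Regular p (x 1) (x 2)) {B B' s w D D₁ W : ℂ}
    (hB : rhoBar p (x 1) (x 2) = B) (hB' : conj (rhoBar p (x 1) (x 2)) = B')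
    (hs : (Real.sin (x 2) : ℂ) = s) (hw : (sqrtTwoDθ p (x 2) : ℂ) = w)
    (hD : (Dr p (x 1) : ℂ) = D) (hD₁ : ((deriv (Dr p) (x 1) : ℝ) : ℂ) = D₁)
    (hW : ((√2 * dSqrtSin p (x 2) : ℝ) : ℂ) = W) :
    npκ p x = 0 ∧ npσ p x = 0 ∧ npν p x = 0 ∧ npLam p x = 0 ∧ npε p x = 0 ∧
    npπ p x = Complex.I * p.a * s * w / (2 * B' ^ 2) ∧
    npβ p x = W / (4 * s * B) ∧
    npγ p x = D₁ / (4 * (B * B')) - D / (2 * (B * B') * B') ∧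
    npρ p x = -1 / B' ∧
    npμ p x = -D / (2 * (B * B') * B') ∧
    npτ p x = -(Complex.I * w * p.a * s) / (2 * (B * B')) ∧
    npα p x = Complex.I * p.a * s * w / (2 * B' ^ 2) - W / (4 * s * B') := by
  have nB := rhoBar_ne_zero h.rho
  have nB' := conj_rhoBar_ne_zero h.rho
  have ns : (Real.sin (x 2) : ℂ) ≠ 0 := by exact_mod_cast h.sin
  have hk : B - B' = 2 * Complex.I * p.a * Real.cos (x 2) := by
    rw [← hB', ← hB, conj_rhoBar, rhoBar]; ring
  have hI := Complex.I_sq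
  have T := @lambdaSymbol_eq_table p x h
  rw [hB', hB, hs, hw, hD, hD₁, hW] at T
  rw [hB] at nB
  rw [hB'] at nB'
  rw [hs] at ns
  simp only [npκ, npσ, npν, npLam, npε, npπ, npβ, npγ, npρ, npμ, npτ, npα, ricciRot,
    lambdaSymbol_self, lambdaSymbol_swap p x 0 _ 1, lambdaSymbol_swap p x 0 _ 2,
    lambdaSymbol_swap p x 0 _ 3, lambdaSymbol_swap p x 1 _ 2, lambdaSymbol_swap p x 1 _ 3,
    lambdaSymbol_swap p x 2 _ 3, T 0 _ 1 (by decide), T 0 _ 2 (by decide), T 0 _ 3 (by decide),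
    T 1 _ 2 (by decide), T 1 _ 3 (by decide), T 2 _ 3 (by decide), rotationTable, Matrix.cons_val]
  clear T hB hB' hs hw hD hD₁ hW
  generalize (Real.cos (x 2) : ℂ) = k at *
  generalize (p.a : ℂ) = a at *
  generalize Complex.I = i at *
  refine ⟨?_, ?_, ?_, ?_, ?_, ?_, ?_, ?_, ?_, ?_, ?_, ?_⟩
  all_goals field_simp
  all_goals try ring1
  all_goals try (clear * - hI hk; grind)

/-! ### The Dirac equation in Newman–Penrose form and its action on modes -/

/-- By skew symmetry the spin connection has components `Γ₀₀ = γ₂₀`, `Γ₀₁ = ½(γ₁₀ + γ₂₃)` and `Γ₁₁ =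
γ₁₃` (tetrad numbered from `0`), which are exactly the spin coefficients. The argument is algebraic
and needs no regularity of the point. -/
lemma halfDirac_iff (p : Params) (x : Point) (q mass : ℝ) (P Q : Spinor) :
    HalfDirac p q mass P Q x ↔
      (frameDeriv p 1 (P 1) x + (-npγ p x + npμ p x + Complex.I * q * potFrame p 1 x) * P 1 x
          + (frameDeriv p 2 (P 0) x + (-npτ p x + npβ p x
            + Complex.I * q * potFrame p 2 x) * P 0 x)
        = -Complex.I * mass * conj (Q 0 x)) ∧
      (-frameDeriv p 0 (P 0) x + (npρ p x - npε p x - Complex.I * q * potFrame p 0 x) * P 0 x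
          + (-frameDeriv p 3 (P 1) x + (npα p x - npπ p x
            - Complex.I * q * potFrame p 3 x) * P 1 x)
        = -Complex.I * mass * conj (Q 1 x)) := by
  -- The component `1̇` is listed first; the component `0̇` is written with the opposite sign, since
  -- lowering gives `Q̄_0̇ = -Q̄^1̇`.
  rw [HalfDirac, Fin.forall_fin_two, and_comm]
  simp only [weylOp, covDeriv, spinConn, lower, conjSpinor, Fin.sum_univ_two, eps, vecIdx,
    Matrix.of_apply, Matrix.cons_val, ricciRot_self, ricciRot_swap p x 2 0, ricciRot_swap p x 1 3,
    ricciRot_swap p x 1 0, ricciRot_swap p x 2 3, npγ, npμ, npτ, npβ, npρ, npε, npα, npπ]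
  constructor
  · rintro ⟨h1, h2⟩
    exact ⟨by linear_combination h1, by linear_combination -h2⟩
  · rintro ⟨h1, h2⟩
    exact ⟨by linear_combination h1, by linear_combination -h2⟩

lemma modePhase_ne_zero (m : ℝ) (ω : ℂ) (x : Point) : modePhase m ω x ≠ 0 := Complex.exp_ne_zero _

lemma pd_zero_mode (m : ℝ) (ω : ℂ) (f : ℝ → ℝ → ℂ) (x : Point) :
    pd 0 (fun y => modePhase m ω y * f (y 1) (y 2)) x =
      -Complex.I * ω * (modePhase m ω x * f (x 1) (x 2)) := by
  have d : HasDerivAt (fun s : ℝ => Complex.exp (Complex.I * (m * x 3 - ω * s)))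
      (Complex.exp (Complex.I * (m * x 3 - ω * x 0)) * (Complex.I * -(ω * 1))) (x 0) :=
    ((((Complex.ofRealCLM.hasDerivAt (x := x 0)).const_mul ω).const_sub _).const_mul _).cexp
  have e : (fun s : ℝ => modePhase m ω (Function.update x 0 s) *
      f (Function.update x 0 s 1) (Function.update x 0 s 2)) =
      fun s : ℝ => Complex.exp (Complex.I * (m * x 3 - ω * s)) * f (x 1) (x 2) := by
    funext s; simp [modePhase]
  rw [pd, e, (d.mul_const _).deriv, modePhase]
  ring

lemma pd_three_mode (m : ℝ) (ω : ℂ) (f : ℝ → ℝ → ℂ) (x : Point) :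
    pd 3 (fun y => modePhase m ω y * f (y 1) (y 2)) x =
      Complex.I * m * (modePhase m ω x * f (x 1) (x 2)) := by
  have d : HasDerivAt (fun s : ℝ => Complex.exp (Complex.I * (m * s - ω * x 0)))
      (Complex.exp (Complex.I * (m * x 3 - ω * x 0)) * (Complex.I * (m * 1))) (x 3) :=
    ((((Complex.ofRealCLM.hasDerivAt (x := x 3)).const_mul (m : ℂ)).sub_const _).const_mul _).cexp
  have e : (fun s : ℝ => modePhase m ω (Function.update x 3 s) *
      f (Function.update x 3 s 1) (Function.update x 3 s 2)) =
      fun s : ℝ => Complex.exp (Complex.I * (m * s - ω * x 0)) * f (x 1) (x 2) := by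
    funext s; simp [modePhase]
  rw [pd, e, (d.mul_const _).deriv, modePhase]
  ring

/-- The phase is constant in `r` and comes out of `deriv` without any differentiability of `f`. -/
lemma pd_one_mode (m : ℝ) (ω : ℂ) (f : ℝ → ℝ → ℂ) (x : Point) :
    pd 1 (fun y => modePhase m ω y * f (y 1) (y 2)) x =
      modePhase m ω x * deriv (fun r => f r (x 2)) (x 1) := by
  have e : (fun s : ℝ => modePhase m ω (Function.update x 1 s) *
      f (Function.update x 1 s 1) (Function.update x 1 s 2)) =
      fun s : ℝ => modePhase m ω x * f s (x 2) := by
    funext s; simp [modePhase]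
  rw [pd, e, deriv_const_mul_field]

lemma pd_two_mode (m : ℝ) (ω : ℂ) (f : ℝ → ℝ → ℂ) (x : Point) :
    pd 2 (fun y => modePhase m ω y * f (y 1) (y 2)) x =
      modePhase m ω x * deriv (f (x 1)) (x 2) := by
  have e : (fun s : ℝ => modePhase m ω (Function.update x 2 s) *
      f (Function.update x 2 s 1) (Function.update x 2 s 2)) =
      fun s : ℝ => modePhase m ω x * f (x 1) s := by
    funext s; simp [modePhase]
  rw [pd, e, deriv_const_mul_field]

/-- On a mode `∂_t = -iω` and `∂_φ = im`. The `t`- and `φ`-components of `l` and `n` then combine to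
multiples of `K`, those of `m` and `m̄` to multiples of `H`. -/
lemma frameDeriv_mode {p : Params} {x : Point} (h : Regular p (x 1) (x 2)) (m : ℝ) (ω : ℂ)
    (f : ℝ → ℝ → ℂ) :
    frameDeriv p 0 (fun y => modePhase m ω y * f (y 1) (y 2)) x =
      modePhase m ω x * (deriv (fun r => f r (x 2)) (x 1) +
        Complex.I * Xi p / Dr p (x 1) * K p m ω (x 1) * f (x 1) (x 2)) ∧
    frameDeriv p 1 (fun y => modePhase m ω y * f (y 1) (y 2)) x =
      modePhase m ω x * (-Dr p (x 1) / (2 * rhoSq p (x 1) (x 2)) *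
        (deriv (fun r => f r (x 2)) (x 1) -
          Complex.I * Xi p * K p m ω (x 1) / Dr p (x 1) * f (x 1) (x 2))) ∧
    frameDeriv p 2 (fun y => modePhase m ω y * f (y 1) (y 2)) x =
      modePhase m ω x *
        ((√(Dθ p (x 2)) : ℝ) / ((√2 : ℝ) * rhoBar p (x 1) (x 2)) *
        (deriv (f (x 1)) (x 2) + Xi p * H p m ω (x 2) / Dθ p (x 2) * f (x 1) (x 2))) ∧
    frameDeriv p 3 (fun y => modePhase m ω y * f (y 1) (y 2)) x =
      modePhase m ω x *
        ((√(Dθ p (x 2)) : ℝ) / ((√2 : ℝ) * conj (rhoBar p (x 1) (x 2))) *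
        (deriv (f (x 1)) (x 2) - Xi p * H p m ω (x 2) / Dθ p (x 2) * f (x 1) (x 2))) := by
  have hB := rhoBar_ne_zero h.rho
  have hB' := conj_rhoBar_ne_zero h.rho
  have hs : (Real.sin (x 2) : ℂ) ≠ 0 := by exact_mod_cast h.sin
  have hD : (Dr p (x 1) : ℂ) ≠ 0 := by exact_mod_cast h.dr
  have hu : ((√(Dθ p (x 2)) : ℝ) : ℂ) ≠ 0 := by exact_mod_cast (Real.sqrt_pos.2 h.dθ).ne'
  have hu2 : (Dθ p (x 2) : ℂ) = ((√(Dθ p (x 2)) : ℝ) : ℂ) ^ 2 := by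
    exact_mod_cast (Real.sq_sqrt h.dθ.le).symm
  have h2 : ((√2 : ℝ) : ℂ) ≠ 0 := by simp
  have h22 : ((√2 : ℝ) : ℂ) ^ 2 = 2 := by norm_cast; simp
  have hI := Complex.I_sq
  simp only [frameDeriv, Fin.sum_univ_four, pd_zero_mode, pd_one_mode, pd_two_mode, pd_three_mode]
  rw [tetrad_eq_frame h, ← rhoBar_mul_conj, hu2, K, H, sqrtTwoDθ_eq]
  push_cast
  simp only [← Complex.ofReal_sin]
  generalize rhoBar p (x 1) (x 2) = B at *
  generalize conj B = B' at *
  generalize (√(Dθ p (x 2)) : ℂ) = u at *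
  generalize (√2 : ℂ) = t at *
  generalize (Dr p (x 1) : ℂ) = D at *
  generalize (Xi p : ℂ) = X at *
  generalize (Real.sin (x 2) : ℂ) = s at *
  generalize (p.a : ℂ) = a at *
  generalize Complex.I = i at *
  generalize modePhase m ω x = e
  generalize deriv (fun r => f r (x 2)) (x 1) = f₁
  generalize deriv (f (x 1)) (x 2) = f₂
  simp only [frame, Matrix.cons_val, zero_mul, add_zero, one_mul]
  refine ⟨?_, ?_, ?_, ?_⟩
  all_goals field_simp
  all_goals try ring1
  all_goals try (clear * - hI h22; grind)

/-- The potential is proportional to `dt - a sin² θ dφ`, which annihilates `m` and `m̄` and takes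
the value `Ξρ²/Δ_r` on `l` and `Ξ/2` on `n`. -/
lemma potFrame_eq {p : Params} {x : Point} (h : Regular p (x 1) (x 2)) :
    potFrame p 0 x = -(p.e * x 1) / Dr p (x 1) ∧
    potFrame p 1 x = -(p.e * x 1) / (2 * (rhoBar p (x 1) (x 2) * conj (rhoBar p (x 1) (x 2)))) ∧
    potFrame p 2 x = 0 ∧ potFrame p 3 x = 0 := by
  have hB := rhoBar_ne_zero h.rho
  have hB' := conj_rhoBar_ne_zero h.rho
  have hs : (Real.sin (x 2) : ℂ) ≠ 0 := by exact_mod_cast h.sin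
  have hw : (sqrtTwoDθ p (x 2) : ℂ) ≠ 0 := by exact_mod_cast (sqrtTwoDθ_pos h.dθ).ne'
  have hD : (Dr p (x 1) : ℂ) ≠ 0 := by exact_mod_cast h.dr
  have hX : (Xi p : ℂ) ≠ 0 := by exact_mod_cast h.xi
  have hρ : x 1 ^ 2 + p.a ^ 2 * Real.cos (x 2) ^ 2 = rhoSq p (x 1) (x 2) := rfl
  simp only [potFrame, Fin.sum_univ_four, potential, formT, hρ, Matrix.cons_val]
  push_cast
  rw [tetrad_eq_frame h, ← rhoBar_mul_conj, rhoSq_add p (x 1) (x 2)]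
  simp only [← Complex.ofReal_sin]
  generalize rhoBar p (x 1) (x 2) = B at *
  generalize conj B = B' at *
  generalize (sqrtTwoDθ p (x 2) : ℂ) = w at *
  generalize (Dr p (x 1) : ℂ) = D at *
  generalize (Xi p : ℂ) = X at *
  generalize (Real.sin (x 2) : ℂ) = s at *
  simp only [frame, Matrix.cons_val]
  refine ⟨?_, ?_, ?_, ?_⟩ <;> field_simp <;> ring

/-! ### Complex conjugation of the tetrad -/

lemma conj_tetrad (p : Params) (x : Point) (j : Fin 4) :
    conj (tetrad p x 0 j) = tetrad p x 0 j ∧ conj (tetrad p x 1 j) = tetrad p x 1 j ∧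
    conj (tetrad p x 2 j) = tetrad p x 3 j ∧ conj (tetrad p x 3 j) = tetrad p x 2 j := by
  fin_cases j <;>
    simp [tetrad, -Complex.ofReal_sin, -Complex.ofReal_mul, -Complex.ofReal_add,
      -Complex.ofReal_div, -Complex.ofReal_neg, -Complex.ofReal_pow] <;> constructor <;> ring

lemma pd_conj (j : Fin 4) (f : Point → ℂ) (x : Point) :
    pd j (fun y => conj (f y)) x = conj (pd j f x) := by
  simp only [pd]
  exact deriv.star

lemma frameDeriv_conj (p : Params) (f : Point → ℂ) (x : Point) {b c : Fin 4}
    (h : ∀ j, conj (tetrad p x c j) = tetrad p x b j) :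
    frameDeriv p b (fun y => conj (f y)) x = conj (frameDeriv p c f x) := by
  simp only [frameDeriv, pd_conj, map_sum, map_mul, h]

lemma potFrame_conj (p : Params) (x : Point) {b c : Fin 4}
    (h : ∀ j, conj (tetrad p x c j) = tetrad p x b j) :
    conj (potFrame p c x) = potFrame p b x := by
  simp only [potFrame, map_sum, map_mul, h, Complex.conj_ofReal]

/-- The equation for `Q`, written for `Q̄`. -/
lemma halfDirac_conj_iff (p : Params) (x : Point) (q mass : ℝ) (P Q : Spinor) :
    HalfDirac p (-q) mass (conjSpinor Q) P x ↔
      (frameDeriv p 1 (Q 1) x + (-conj (npγ p x) + conj (npμ p x)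
          + Complex.I * q * potFrame p 1 x) * Q 1 x
          + (frameDeriv p 3 (Q 0) x + (-conj (npτ p x) + conj (npβ p x)
            + Complex.I * q * potFrame p 3 x) * Q 0 x)
        = Complex.I * mass * P 0 x) ∧
      (-frameDeriv p 0 (Q 0) x + (conj (npρ p x) - conj (npε p x)
          - Complex.I * q * potFrame p 0 x) * Q 0 x
          + (-frameDeriv p 2 (Q 1) x + (conj (npα p x) - conj (npπ p x)
            - Complex.I * q * potFrame p 2 x) * Q 1 x)
        = Complex.I * mass * P 1 x) := by
  have t := conj_tetrad p x
  have F0 : ∀ f : Point → ℂ, _ := fun f => frameDeriv_conj p f x (fun j => (t j).1)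
  have F1 : ∀ f : Point → ℂ, _ := fun f => frameDeriv_conj p f x (fun j => (t j).2.1)
  have F3 : ∀ f : Point → ℂ, _ := fun f => frameDeriv_conj p f x (fun j => (t j).2.2.1)
  have F2 : ∀ f : Point → ℂ, _ := fun f => frameDeriv_conj p f x (fun j => (t j).2.2.2)
  have A0 := potFrame_conj p x (fun j => (t j).1)
  have A1 := potFrame_conj p x (fun j => (t j).2.1)
  have A3 := potFrame_conj p x (fun j => (t j).2.2.1)
  have A2 := potFrame_conj p x (fun j => (t j).2.2.2)
  have C : ∀ i, conjSpinor Q i = fun y => conj (Q i y) := fun i => rfl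
  rw [halfDirac_iff]
  -- Conjugating both sides fixes `l` and `n`, exchanges `m` and `m̄`, and turns the charge `-q`
  -- into `q`.
  refine and_congr ?_ ?_ <;> rw [← (starRingEnd ℂ).injective.eq_iff] <;>
    simp [C, F0, F1, F2, F3, A0, A1, A2, A3, sub_eq_add_neg]

/-! ### Product solutions -/

/-- The operators of the separated equations, without the separation constant. -/
def radialOp₁ (p : Params) (q μ m : ℝ) (ω : ℂ) (Rm Rp : ℝ → ℂ) (r : ℝ) : ℂ :=
  (√(Dr p r) : ℝ) * (deriv Rm r + Complex.I * Xi p * K p m ω r / Dr p r * Rm r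
    - Complex.I * q * p.e * r / Dr p r * Rm r) - Complex.I * μ * r * Rp r

def radialOp₂ (p : Params) (q μ m : ℝ) (ω : ℂ) (Rm Rp : ℝ → ℂ) (r : ℝ) : ℂ :=
  (√(Dr p r) : ℝ) * (deriv Rp r - Complex.I * Xi p * K p m ω r / Dr p r * Rp r
    + Complex.I * q * p.e * r / Dr p r * Rp r) + Complex.I * μ * r * Rm r

def angularOp₁ (p : Params) (μ m : ℝ) (ω : ℂ) (Sm Sp : ℝ → ℂ) (θ : ℝ) : ℂ :=
  (√(Dθ p θ) : ℝ) * (deriv Sp θ - Xi p * H p m ω θ / Dθ p θ * Sp θ)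
    + dSqrtSin p θ / (2 * Real.sin θ) * Sp θ - μ * p.a * Real.cos θ * Sm θ

def angularOp₂ (p : Params) (μ m : ℝ) (ω : ℂ) (Sm Sp : ℝ → ℂ) (θ : ℝ) : ℂ :=
  (√(Dθ p θ) : ℝ) * (deriv Sm θ + Xi p * H p m ω θ / Dθ p θ * Sm θ)
    + dSqrtSin p θ / (2 * Real.sin θ) * Sm θ - μ * p.a * Real.cos θ * Sp θ

lemma radialEqs_iff {p : Params} {r : ℝ} (h : 0 < Dr p r) (q μ m : ℝ) (ω lam : ℂ)
    (Rm Rp : ℝ → ℂ) :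
    RadialEqs p q μ m ω lam Rm Rp r ↔ radialOp₁ p q μ m ω Rm Rp r = lam * Rp r ∧
      radialOp₂ p q μ m ω Rm Rp r = lam * Rm r := by
  have hd : ((√(Dr p r) : ℝ) : ℂ) ≠ 0 := by exact_mod_cast (Real.sqrt_pos.2 h).ne'
  have hd2 : (Dr p r : ℂ) = ((√(Dr p r) : ℝ) : ℂ) ^ 2 := by
    exact_mod_cast (Real.sq_sqrt h.le).symm
  rw [RadialEqs, radialOp₁, radialOp₂, hd2, K]
  generalize (√(Dr p r) : ℂ) = d at *
  have e : d * (deriv Rp r - Complex.I * Xi p * (m * p.a - ω * (r ^ 2 + p.a ^ 2)) / d ^ 2 * Rp r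
      + Complex.I * q * p.e * r / d ^ 2 * Rp r) = d * deriv Rp r
      - Complex.I * Xi p * (m * p.a - ω * (r ^ 2 + p.a ^ 2)) * Rp r / d
      + Complex.I * p.e * q * r * Rp r / d := by
    field_simp
  rw [e]
  constructor
  · rintro ⟨h1, h2⟩
    exact ⟨by linear_combination h1, by linear_combination h2⟩
  · rintro ⟨h1, h2⟩
    exact ⟨by linear_combination h1, by linear_combination h2⟩

lemma angularEqs_iff {p : Params} {θ : ℝ} (h : 0 < Dθ p θ) (μ m : ℝ) (ω lam : ℂ)
    (Sm Sp : ℝ → ℂ) :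
    AngularEqs p μ m ω lam Sm Sp θ ↔ angularOp₁ p μ m ω Sm Sp θ = -(lam * Sm θ) ∧
      angularOp₂ p μ m ω Sm Sp θ = lam * Sp θ := by
  have hd : ((√(Dθ p θ) : ℝ) : ℂ) ≠ 0 := by exact_mod_cast (Real.sqrt_pos.2 h).ne'
  have hd2 : (Dθ p θ : ℂ) = ((√(Dθ p θ) : ℝ) : ℂ) ^ 2 := by
    exact_mod_cast (Real.sq_sqrt h.le).symm
  rw [AngularEqs, angularOp₁, angularOp₂, hd2, H]
  generalize (√(Dθ p θ) : ℂ) = d at *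
  have e1 : d ^ 2 / d = d := by field_simp
  have e2 : ∀ z : ℂ, d * (Xi p * z / d ^ 2) = z * Xi p / d := fun z => by field_simp
  rw [e1]
  constructor
  · rintro ⟨h1, h2⟩
    exact ⟨by linear_combination h1 - Sp θ * e2 (ω * p.a * Real.sin θ - m / Real.sin θ),
      by linear_combination h2 + Sm θ * e2 (ω * p.a * Real.sin θ - m / Real.sin θ)⟩
  · rintro ⟨h1, h2⟩
    exact ⟨by linear_combination h1 + Sp θ * e2 (ω * p.a * Real.sin θ - m / Real.sin θ),
      by linear_combination h2 - Sm θ * e2 (ω * p.a * Real.sin θ - m / Real.sin θ)⟩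

/-- Serves to identify a Dirac component with a separated relation up to a nonvanishing prefactor
`k`. -/
lemma eq_iff_eq_of_sub_eq_mul {F : Type*} [Field F] {a b c d k : F} (hk : k ≠ 0)
    (h : a - b = k * (c - d)) : a = b ↔ c = d := by
  rw [← sub_eq_zero, h, mul_eq_zero, or_iff_right hk, sub_eq_zero]

/-- The Dirac equation for the separation ansatz, at a point. -/
lemma dirac_ansatz_iff {p : Params} {x : Point} (h : Regular p (x 1) (x 2)) (hr : 0 < Dr p (x 1))
    (q μ m : ℝ) (ω : ℂ) {Rm Rp Sm Sp : ℝ → ℂ}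
    (hRm : DifferentiableAt ℝ Rm (x 1)) (hRp : DifferentiableAt ℝ Rp (x 1))
    (hSm : DifferentiableAt ℝ Sm (x 2)) (hSp : DifferentiableAt ℝ Sp (x 2)) :
    Dirac p q (μ / √2) (ansatzP p m ω Rm Rp Sm Sp)
      (conjSpinor (ansatzQbar p m ω Rm Rp Sm Sp)) x ↔
    (radialOp₂ p q μ m ω Rm Rp (x 1) * Sp (x 2) = Rm (x 1) * angularOp₂ p μ m ω Sm Sp (x 2) ∧
      radialOp₁ p q μ m ω Rm Rp (x 1) * Sm (x 2) = -(Rp (x 1) * angularOp₁ p μ m ω Sm Sp (x 2))) ∧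
    (radialOp₂ p q μ m ω Rm Rp (x 1) * Sm (x 2) = -(Rm (x 1) * angularOp₁ p μ m ω Sm Sp (x 2)) ∧
      radialOp₁ p q μ m ω Rm Rp (x 1) * Sp (x 2) = Rp (x 1) * angularOp₂ p μ m ω Sm Sp (x 2)) := by
  have nB := rhoBar_ne_zero h.rho
  have nB' := conj_rhoBar_ne_zero h.rho
  have ns : (Real.sin (x 2) : ℂ) ≠ 0 := by exact_mod_cast h.sin
  have nu : ((√(Dθ p (x 2)) : ℝ) : ℂ) ≠ 0 := by exact_mod_cast (Real.sqrt_pos.2 h.dθ).ne'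
  have hu : (Dθ p (x 2) : ℂ) = ((√(Dθ p (x 2)) : ℝ) : ℂ) ^ 2 := by
    exact_mod_cast (Real.sq_sqrt h.dθ.le).symm
  have nd : ((√(Dr p (x 1)) : ℝ) : ℂ) ≠ 0 := by exact_mod_cast (Real.sqrt_pos.2 hr).ne'
  have hd : (Dr p (x 1) : ℂ) = ((√(Dr p (x 1)) : ℝ) : ℂ) ^ 2 := by
    exact_mod_cast (Real.sq_sqrt hr.le).symm
  have nt : ((√2 : ℝ) : ℂ) ≠ 0 := by simp
  have ht : ((√2 : ℝ) : ℂ) ^ 2 = 2 := by norm_cast; simp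
  have hw : (sqrtTwoDθ p (x 2) : ℂ) = ((√2 : ℝ) : ℂ) * ((√(Dθ p (x 2)) : ℝ) : ℂ) := by
    rw [sqrtTwoDθ_eq]; push_cast; rfl
  -- The `r` and `a cos θ` in the separated operators are written through `B` and `B'`, so that they
  -- match the factor `ρ̄` or `ρ̄*` of the mass term.
  have hrB : (x 1 : ℂ) = (rhoBar p (x 1) (x 2) + conj (rhoBar p (x 1) (x 2))) / 2 := by
    rw [conj_rhoBar, rhoBar]; ring
  have hc : (p.a : ℂ) * Real.cos (x 2) =
      -Complex.I * (rhoBar p (x 1) (x 2) - conj (rhoBar p (x 1) (x 2))) / 2 := by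
    rw [conj_rhoBar, rhoBar]
    linear_combination (p.a : ℂ) * Real.cos (x 2) * Complex.I_sq
  have hI := Complex.I_sq
  have ne := modePhase_ne_zero m ω x
  obtain ⟨-, -, -, -, eε, eπ, eβ, eγ, eρ, eμ, eτ, eα⟩ := spinCoefficients h rfl rfl rfl rfl rfl
    rfl rfl
  obtain ⟨a0, a1, a2, a3⟩ := potFrame_eq h
  -- the derivatives of the factors
  have dBr := hasDerivAt_rhoBar_r p (x 1) (x 2)
  have dBr' := hasDerivAt_conj_rhoBar_r p (x 1) (x 2)
  have dBθ := hasDerivAt_rhoBar_θ p (x 1) (x 2)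
  have dBθ' := hasDerivAt_conj_rhoBar_θ p (x 1) (x 2)
  have dd : HasDerivAt (fun s : ℝ => ((√(Dr p s) : ℝ) : ℂ))
      ((deriv (Dr p) (x 1) : ℝ) / (2 * (√(Dr p (x 1)) : ℝ))) (x 1) := by
    have := (((differentiable_Dr p) (x 1)).hasDerivAt.sqrt hr.ne').ofReal_comp
    exact this.congr_deriv (by push_cast; rfl)
  have P0 := frameDeriv_mode h m ω (fun r θ => Sm θ * Rm r / ((√2 : ℝ) * conj (rhoBar p r θ)))
  have P1 := frameDeriv_mode h m ω (fun r θ => Sp θ * Rp r / (√(Dr p r) : ℝ))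
  have Q0 := frameDeriv_mode h m ω (fun r θ => -(Sp θ * Rm r) / ((√2 : ℝ) * rhoBar p r θ))
  have Q1 := frameDeriv_mode h m ω (fun r θ => Sm θ * Rp r / (√(Dr p r) : ℝ))
  have P0r : deriv (fun r => Sm (x 2) * Rm r / ((√2 : ℝ) * conj (rhoBar p r (x 2)))) (x 1) = _ :=
    ((hRm.hasDerivAt.const_mul (Sm (x 2))).div (dBr'.const_mul ((√2 : ℝ) : ℂ))
      (mul_ne_zero nt nB')).deriv
  have P0θ : deriv (fun θ => Sm θ * Rm (x 1) / ((√2 : ℝ) * conj (rhoBar p (x 1) θ))) (x 2) = _ :=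
    ((hSm.hasDerivAt.mul_const (Rm (x 1))).div (dBθ'.const_mul ((√2 : ℝ) : ℂ))
      (mul_ne_zero nt nB')).deriv
  have P1r : deriv (fun r => Sp (x 2) * Rp r / (√(Dr p r) : ℝ)) (x 1) = _ :=
    ((hRp.hasDerivAt.const_mul (Sp (x 2))).div dd nd).deriv
  have P1θ : deriv (fun θ => Sp θ * Rp (x 1) / (√(Dr p (x 1)) : ℝ)) (x 2) = _ :=
    ((hSp.hasDerivAt.mul_const (Rp (x 1))).div_const ((√(Dr p (x 1)) : ℝ) : ℂ)).deriv
  have Q0r : deriv (fun r => -(Sp (x 2) * Rm r) / ((√2 : ℝ) * rhoBar p r (x 2))) (x 1) = _ :=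
    ((hRm.hasDerivAt.const_mul (Sp (x 2))).fun_neg.div (dBr.const_mul ((√2 : ℝ) : ℂ))
      (mul_ne_zero nt nB)).deriv
  have Q0θ : deriv (fun θ => -(Sp θ * Rm (x 1)) / ((√2 : ℝ) * rhoBar p (x 1) θ)) (x 2) = _ :=
    ((hSp.hasDerivAt.mul_const (Rm (x 1))).fun_neg.div (dBθ.const_mul ((√2 : ℝ) : ℂ))
      (mul_ne_zero nt nB)).deriv
  have Q1r : deriv (fun r => Sm (x 2) * Rp r / (√(Dr p r) : ℝ)) (x 1) = _ :=
    ((hRp.hasDerivAt.const_mul (Sm (x 2))).div dd nd).deriv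
  have Q1θ : deriv (fun θ => Sm θ * Rp (x 1) / (√(Dr p (x 1)) : ℝ)) (x 2) = _ :=
    ((hSm.hasDerivAt.mul_const (Rp (x 1))).div_const ((√(Dr p (x 1)) : ℝ) : ℂ)).deriv
  have eP0 : ansatzP p m ω Rm Rp Sm Sp 0 = fun y => modePhase m ω y *
      (fun r θ => Sm θ * Rm r / ((√2 : ℝ) * conj (rhoBar p r θ))) (y 1) (y 2) := by
    funext y; simp only [ansatzP, Matrix.cons_val]; ring
  have eP1 : ansatzP p m ω Rm Rp Sm Sp 1 = fun y => modePhase m ω y *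
      (fun r θ => Sp θ * Rp r / (√(Dr p r) : ℝ)) (y 1) (y 2) := by
    funext y; simp only [ansatzP, Matrix.cons_val]; ring
  have eQ0 : ansatzQbar p m ω Rm Rp Sm Sp 0 = fun y => modePhase m ω y *
      (fun r θ => -(Sp θ * Rm r) / ((√2 : ℝ) * rhoBar p r θ)) (y 1) (y 2) := by
    funext y; simp only [ansatzQbar, Matrix.cons_val]; ring
  have eQ1 : ansatzQbar p m ω Rm Rp Sm Sp 1 = fun y => modePhase m ω y *
      (fun r θ => Sm θ * Rp r / (√(Dr p r) : ℝ)) (y 1) (y 2) := by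
    funext y; simp only [ansatzQbar, Matrix.cons_val]; ring
  have eQ : ∀ i, conj (conjSpinor (ansatzQbar p m ω Rm Rp Sm Sp) i x) =
      ansatzQbar p m ω Rm Rp Sm Sp i x := fun i => by simp [conjSpinor]
  rw [Dirac, halfDirac_iff, halfDirac_conj_iff, eQ, eQ, eε, eπ, eβ, eγ, eρ, eμ, eτ, eα, a0, a1, a2,
    a3, eP0, eP1, eQ0, eQ1, P0.1, P0.2.2.1, P1.2.1, P1.2.2.2, Q0.1, Q0.2.2.2, Q1.2.1, Q1.2.2.1]
  simp only [P0r, P0θ, P1r, P1θ, Q0r, Q0θ, Q1r, Q1θ]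
  rw [← rhoBar_mul_conj, radialOp₁, radialOp₂, angularOp₁, angularOp₂, hw, hu, hd, mul_assoc (μ :
    ℂ),
    hc, hrB]
  clear P0 P1 Q0 Q1 P0r P0θ P1r P1θ Q0r Q0θ Q1r Q1θ eP0 eP1 eQ0 eQ1 eQ eε eπ eβ eγ eρ eμ eτ eα a0 a1
    a2 a3 dBr dBr' dBθ dBθ' dd hw hu hd hc hrB
  push_cast
  simp only [← Complex.ofReal_sin, Complex.conj_ofReal, map_div₀, map_mul, map_neg, map_sub,
    map_ofNat,
    Complex.conj_I, Complex.conj_conj, map_one, map_pow, map_zero, mul_zero]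
  generalize rhoBar p (x 1) (x 2) = B at *
  generalize conj B = B' at *
  generalize (√(Dθ p (x 2)) : ℂ) = u at *
  generalize (√2 : ℂ) = t at *
  generalize (√(Dr p (x 1)) : ℂ) = d at *
  generalize (Xi p : ℂ) = X at *
  generalize (dSqrtSin p (x 2) : ℂ) = W at *
  generalize ((deriv (Dr p) (x 1) : ℝ) : ℂ) = D₁ at *
  generalize (Real.sin (x 2) : ℂ) = s at *
  generalize (p.a : ℂ) = a at *
  generalize Complex.I = i at *
  generalize modePhase m ω x = e at *
  generalize deriv Rm (x 1) = Rm₁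
  generalize deriv Rp (x 1) = Rp₁
  generalize deriv Sm (x 2) = Sm₁
  generalize deriv Sp (x 2) = Sp₁
  generalize K p m ω (x 1) = k
  generalize H p m ω (x 2) = η
  refine and_congr (and_congr ?_ ?_) (and_congr ?_ ?_)
  · refine eq_iff_eq_of_sub_eq_mul (k := -e / (2 * (B * B'))) (by simp [*]) ?_
    field_simp
    clear * - hI ht
    grind
  · refine eq_iff_eq_of_sub_eq_mul (k := -e / (t * B' * d)) (by simp [*]) ?_
    field_simp
    clear * - hI ht
    grind
  · refine eq_iff_eq_of_sub_eq_mul (k := -e / (2 * (B * B'))) (by simp [*]) ?_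
    field_simp
    clear * - hI ht
    grind
  · refine eq_iff_eq_of_sub_eq_mul (k := e / (t * B * d)) (by simp [*]) ?_
    field_simp
    clear * - hI ht
    grind

/-- Separation of variables for two coupled pairs of functions. -/
lemma exists_separation_constant {α β F : Type*} [Field F] {I : Set α} {J : Set β}
    {A₁ A₂ Rm Rp : α → F} {B₁ B₂ Sm Sp : β → F}
    (hR : ∃ r ∈ I, Rm r ≠ 0 ∨ Rp r ≠ 0) (hS : ∃ θ ∈ J, Sm θ ≠ 0 ∨ Sp θ ≠ 0)
    (h : ∀ r ∈ I, ∀ θ ∈ J,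
      (A₂ r * Sp θ = Rm r * B₂ θ ∧ A₁ r * Sm θ = -(Rp r * B₁ θ)) ∧
      (A₂ r * Sm θ = -(Rm r * B₁ θ) ∧ A₁ r * Sp θ = Rp r * B₂ θ)) :
    ∃ lam : F, (∀ r ∈ I, A₁ r = lam * Rp r ∧ A₂ r = lam * Rm r) ∧
      ∀ θ ∈ J, B₁ θ = -(lam * Sm θ) ∧ B₂ θ = lam * Sp θ := by
  have key : ∃ lam : F, ∀ θ ∈ J, B₁ θ = -(lam * Sm θ) ∧ B₂ θ = lam * Sp θ := by
    obtain ⟨r, hr, h0 | h0⟩ := hR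
    -- At this fixed `r` the ratio does not depend on `θ`, and both relations containing `Rm r`
    -- yield the same constant.
    · refine ⟨A₂ r / Rm r, fun θ hθ => ?_⟩
      obtain ⟨⟨e1, -⟩, e2, -⟩ := h r hr θ hθ
      constructor
      · field_simp; linear_combination e2
      · field_simp; linear_combination -e1
    · refine ⟨A₁ r / Rp r, fun θ hθ => ?_⟩
      obtain ⟨⟨-, e1⟩, -, e2⟩ := h r hr θ hθ
      constructor
      · field_simp; linear_combination e1
      · field_simp; linear_combination -e2
  obtain ⟨lam, hlam⟩ := key
  refine ⟨lam, fun r hr => ?_, hlam⟩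
  -- With the angular equations known, a nonzero value of `Sm` or `Sp` can be cancelled from the two
  -- relations that contain it.
  obtain ⟨θ, hθ, h0 | h0⟩ := hS <;> obtain ⟨⟨e1, e2⟩, e3, e4⟩ := h r hr θ hθ <;>
    obtain ⟨b1, b2⟩ := hlam θ hθ <;> constructor <;> refine mul_right_cancel₀ h0 ?_
  · linear_combination e2 - Rp r * b1
  · linear_combination e3 - Rm r * b1
  · linear_combination e4 + Rp r * b2
  · linear_combination e1 + Rm r * b2

/-! ### The Kerr–Newman case -/

lemma Xi_of_Λ_eq_zero {p : Params} (h : p.Λ = 0) : Xi p = 1 := by simp [Xi, h]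

lemma Dr_of_Λ_eq_zero {p : Params} (h : p.Λ = 0) : Dr p = DKN p := by
  funext r
  simp only [Dr, DKN, h]
  ring

lemma Dθ_of_Λ_eq_zero {p : Params} (h : p.Λ = 0) (θ : ℝ) : Dθ p θ = 1 := by simp [Dθ, h]

lemma dSqrtSin_of_Λ_eq_zero {p : Params} (h : p.Λ = 0) (θ : ℝ) : dSqrtSin p θ = Real.cos θ := by
  simp [dSqrtSin, Dθ_of_Λ_eq_zero h]

lemma radialEqs_iff_KN {p : Params} (h : p.Λ = 0) (q μ m : ℝ) (ω lam : ℂ) (Rm Rp : ℝ → ℂ)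
    (r : ℝ) :
    RadialEqs p q μ m ω lam Rm Rp r ↔ KNRadialEqs p q μ m ω lam Rm Rp r := by
  rw [RadialEqs, KNRadialEqs, Dr_of_Λ_eq_zero h, Xi_of_Λ_eq_zero h]
  refine and_congr (Eq.congr_left ?_) (Eq.congr_left ?_) <;> push_cast <;> ring

lemma angularEqs_iff_KN {p : Params} (h : p.Λ = 0) (μ m : ℝ) (ω lam : ℂ) (Sm Sp : ℝ → ℂ)
    (θ : ℝ) :
    AngularEqs p μ m ω lam Sm Sp θ ↔ KNAngularEqs p μ m ω lam Sm Sp θ := by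
  rw [AngularEqs, KNAngularEqs, Dθ_of_Λ_eq_zero h, Xi_of_Λ_eq_zero h, dSqrtSin_of_Λ_eq_zero h]
  refine and_congr (Eq.congr_left ?_) (Eq.congr_left ?_) <;> simp <;> ring

/-- The frequency and charge terms combine into `𝒦 = eqr - K`, which enters the two equations with
opposite signs. -/
lemma KNRadialEqs.deriv_eq {p : Params} {q μ m : ℝ} {ω lam : ℂ} {Rm Rp : ℝ → ℂ} {r : ℝ}
    (hD : 0 < DKN p r) (h : KNRadialEqs p q μ m ω lam Rm Rp r) :
    deriv Rm r = (lam + Complex.I * μ * r) * Rp r / (√(DKN p r) : ℝ)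
      + Complex.I * KPage p q m ω r * Rm r / DKN p r ∧
    deriv Rp r = (lam - Complex.I * μ * r) * Rm r / (√(DKN p r) : ℝ)
      - Complex.I * KPage p q m ω r * Rp r / DKN p r := by
  have nd : ((√(DKN p r) : ℝ) : ℂ) ≠ 0 := by exact_mod_cast (Real.sqrt_pos.2 hD).ne'
  have hd : (DKN p r : ℂ) = ((√(DKN p r) : ℝ) : ℂ) ^ 2 := by
    exact_mod_cast (Real.sq_sqrt hD.le).symm
  obtain ⟨h1, h2⟩ := h
  rw [hd] at h1 ⊢
  rw [KPage]
  generalize (√(DKN p r) : ℂ) = d at *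
  field_simp at h1 h2 ⊢
  constructor
  · linear_combination h1
  · linear_combination h2

lemma hasDerivAt_KPage (p : Params) (q m : ℝ) (ω : ℂ) (r : ℝ) :
    HasDerivAt (KPage p q m ω) (2 * r * ω + p.e * q) r := by
  have d := Complex.ofRealCLM.hasDerivAt (x := r)
  have := ((((d.pow 2).add_const ((p.a : ℂ) ^ 2)).mul_const ω).sub_const ((m : ℂ) * p.a)).add
    (d.const_mul ((p.e : ℂ) * q))
  exact this.congr_deriv (by simp)

lemma hasDerivAt_DKN (p : Params) (r : ℝ) : HasDerivAt (DKN p) (2 * r - 2 * p.M) r := by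
  have d := hasDerivAt_id' r
  have := ((((d.pow 2).add_const (p.a ^ 2)).add_const (p.e ^ 2))).sub (d.const_mul (2 * p.M))
  exact this.congr_deriv (by simp)

/-- The second-order radial equation for `R^{(-)}`. -/
lemma pageRadial_of_KNRadialEqs {p : Params} {q μ m : ℝ} {ω lam : ℂ} {Rm Rp : ℝ → ℂ} {I : Set ℝ}
    (hI : IsOpen I) (hD : ∀ r ∈ I, 0 < DKN p r)
    (hR : ∀ r ∈ I, DifferentiableAt ℝ Rm r ∧ DifferentiableAt ℝ Rp r)
    (h : ∀ r ∈ I, KNRadialEqs p q μ m ω lam Rm Rp r) {r : ℝ} (hr : r ∈ I)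
    (hlam : lam + Complex.I * μ * r ≠ 0) :
    DifferentiableAt ℝ (deriv Rm) r ∧ PageRadial p q μ m ω lam Rm r := by
  have hDr := hD r hr
  have nd : ((√(DKN p r) : ℝ) : ℂ) ≠ 0 := by exact_mod_cast (Real.sqrt_pos.2 hDr).ne'
  have nD : (DKN p r : ℂ) ≠ 0 := by exact_mod_cast hDr.ne'
  have hd : (DKN p r : ℂ) = ((√(DKN p r) : ℝ) : ℂ) ^ 2 := by
    exact_mod_cast (Real.sq_sqrt hDr.le).symm
  obtain ⟨e1, e2⟩ := (h r hr).deriv_eq hDr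
  have d1 := (hR r hr).1.hasDerivAt
  have d2 := (hR r hr).2.hasDerivAt
  have dD := (hasDerivAt_DKN p r).ofReal_comp
  have dd := ((hasDerivAt_DKN p r).sqrt hDr.ne').ofReal_comp
  have dl := ((Complex.ofRealCLM.hasDerivAt (x := r)).const_mul (Complex.I * μ)).const_add lam
  -- The first-order equation holds on a neighbourhood, so `deriv Rm` agrees there with an
  -- expression differentiable at `r`.
  have key : HasDerivAt (deriv Rm) _ r :=
    (((dl.mul d2).div dd nd).add
      ((((hasDerivAt_KPage p q m ω r).const_mul Complex.I).mul d1).div dD nD)).congr_of_eventuallyEq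
      (by filter_upwards [hI.mem_nhds hr] with s hs using ((h s hs).deriv_eq (hD s hs)).1)
  refine ⟨key.differentiableAt, ?_⟩
  -- With both first derivatives replaced, an identity in the values of `Rm` and `Rp` remains, in
  -- which the terms with `Rp` cancel.
  rw [PageRadial, key.deriv, e1, e2, hd]
  have hII := Complex.I_sq
  simp only [Pi.mul_apply, Complex.ofRealCLM_apply]
  push_cast
  clear dl dd dD d1 d2 e1 e2 key hd nD
  generalize (√(DKN p r) : ℂ) = d at *
  generalize Complex.I = i at *
  generalize KPage p q m ω r = k at *
  field_simp
  clear * - hII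
  grind

lemma KNAngularEqs.deriv_eq {p : Params} {μ m : ℝ} {ω lam : ℂ} {Sm Sp : ℝ → ℂ} {θ : ℝ}
    (h : KNAngularEqs p μ m ω lam Sm Sp θ) :
    deriv Sp θ = (-lam + μ * p.a * Real.cos θ) * Sm θ
      - (m / Real.sin θ - ω * p.a * Real.sin θ + Real.cos θ / (2 * Real.sin θ)) * Sp θ ∧
    deriv Sm θ = (lam + μ * p.a * Real.cos θ) * Sp θ
      - (ω * p.a * Real.sin θ - m / Real.sin θ + Real.cos θ / (2 * Real.sin θ)) * Sm θ :=
  ⟨by linear_combination h.1, by linear_combination h.2⟩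

/-- The second-order angular equation for `S^{(-)}`. -/
lemma pageAngular_of_KNAngularEqs {p : Params} {μ m : ℝ} {ω lam : ℂ} {Sm Sp : ℝ → ℂ} {J : Set ℝ}
    (hJ : IsOpen J) (hsin : ∀ θ ∈ J, Real.sin θ ≠ 0)
    (hS : ∀ θ ∈ J, DifferentiableAt ℝ Sm θ ∧ DifferentiableAt ℝ Sp θ)
    (h : ∀ θ ∈ J, KNAngularEqs p μ m ω lam Sm Sp θ) {θ : ℝ} (hθ : θ ∈ J)
    (hlam : lam + μ * p.a * Real.cos θ ≠ 0) :
    DifferentiableAt ℝ (deriv Sm) θ ∧ PageAngular p μ m ω lam Sm θ := by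
  have ns : (Real.sin θ : ℂ) ≠ 0 := by exact_mod_cast hsin θ hθ
  have ns2 : 2 * (Real.sin θ : ℂ) ≠ 0 := mul_ne_zero two_ne_zero ns
  obtain ⟨e1, e2⟩ := (h θ hθ).deriv_eq
  have d1 := (hS θ hθ).1.hasDerivAt
  have d2 := (hS θ hθ).2.hasDerivAt
  have ds := (Real.hasDerivAt_sin θ).ofReal_comp
  have dc := (Real.hasDerivAt_cos θ).ofReal_comp
  have key : HasDerivAt (deriv Sm) _ θ :=
    ((((dc.const_mul (μ * p.a : ℂ)).const_add lam).mul d2).sub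
      ((((ds.const_mul (ω * p.a)).sub ((hasDerivAt_const θ (m : ℂ)).div ds ns)).add
        (dc.div (ds.const_mul 2) ns2)).mul d1)).congr_of_eventuallyEq
      (by filter_upwards [hJ.mem_nhds hθ] with s hs using (h s hs).deriv_eq.2)
  refine ⟨key.differentiableAt, ?_⟩
  -- The only trigonometric relation needed once the first derivatives have been eliminated.
  have hsc : (Real.sin θ : ℂ) ^ 2 + (Real.cos θ : ℂ) ^ 2 = 1 := by
    exact_mod_cast Real.sin_sq_add_cos_sq θ
  rw [PageAngular, key.deriv, e2, e1]
  simp only [Pi.sub_apply, Pi.add_apply, Pi.div_apply]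
  push_cast
  simp only [← Complex.ofReal_sin, ← Complex.ofReal_cos]
  clear ds dc d1 d2 e1 e2 key
  generalize (Real.sin θ : ℂ) = s at *
  generalize (Real.cos θ : ℂ) = c at *
  field_simp
  clear * - hsc
  grind

end KNdS

end

/-! ### Assembly of the three statements -/

theorem mainTheorem2 (p : KNdS.Params) (hXi : KNdS.Xi p ≠ 0) (q μ m : ℝ) (ω : ℂ) :
    -- the tetrad, its spin coefficients and the Dirac equation in the tetrad
    (∀ x : KNdS.Point, KNdS.Dr p (x 1) ≠ 0 → 0 < x 2 → x 2 < Real.pi → 0 < KNdS.Dθ p (x 2) →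
      KNdS.rhoSq p (x 1) (x 2) ≠ 0 →
      -- the tetrad is a null tetrad
      (∀ b c : Fin 4, ∑ i, ∑ j, (KNdS.metric p x i j : ℂ) * KNdS.tetrad p x b i *
        KNdS.tetrad p x c j = KNdS.nullEta b c) ∧
      -- the spin coefficients
      KNdS.npκ p x = 0 ∧ KNdS.npσ p x = 0 ∧ KNdS.npν p x = 0 ∧ KNdS.npLam p x = 0 ∧
      KNdS.npε p x = 0 ∧
      KNdS.npπ p x = 1 / 2 * (Complex.I * p.a * Real.sin (x 2) * (√(2 * KNdS.Dθ p (x 2)) : ℝ) /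
        conj (KNdS.rhoBar p (x 1) (x 2)) ^ 2) ∧
      KNdS.npβ p x = 1 / (2 * Real.sin (x 2) * (√2 : ℝ) * KNdS.rhoBar p (x 1) (x 2)) *
        KNdS.dSqrtSin p (x 2) ∧
      KNdS.npγ p x = 1 / (4 * KNdS.rhoSq p (x 1) (x 2)) * (deriv (KNdS.Dr p) (x 1) : ℝ) -
        1 / (2 * KNdS.rhoSq p (x 1) (x 2) * conj (KNdS.rhoBar p (x 1) (x 2))) *
          KNdS.Dr p (x 1) ∧
      KNdS.npρ p x = -1 / conj (KNdS.rhoBar p (x 1) (x 2)) ∧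
      KNdS.npμ p x = -KNdS.Dr p (x 1) /
        (2 * KNdS.rhoSq p (x 1) (x 2) * conj (KNdS.rhoBar p (x 1) (x 2))) ∧
      KNdS.npτ p x = -Complex.I * (√(2 * KNdS.Dθ p (x 2)) : ℝ) * p.a * Real.sin (x 2) /
        (2 * KNdS.rhoSq p (x 1) (x 2)) ∧
      KNdS.npα p x = KNdS.npπ p x - conj (KNdS.npβ p x) ∧
      -- the components of the two-spinor Dirac equation (for every charge `q'`)
      (∀ (q' mass : ℝ) (P Q : KNdS.Spinor), KNdS.HalfDirac p q' mass P Q x ↔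
        (KNdS.frameDeriv p 1 (P 1) x + (-KNdS.npγ p x + KNdS.npμ p x
              + Complex.I * q' * KNdS.potFrame p 1 x) * P 1 x
            + (KNdS.frameDeriv p 2 (P 0) x + (-KNdS.npτ p x + KNdS.npβ p x
              + Complex.I * q' * KNdS.potFrame p 2 x) * P 0 x)
          = -Complex.I * mass * conj (Q 0 x)) ∧
        (-KNdS.frameDeriv p 0 (P 0) x + (KNdS.npρ p x - KNdS.npε p x
              - Complex.I * q' * KNdS.potFrame p 0 x) * P 0 x
            + (-KNdS.frameDeriv p 3 (P 1) x + (KNdS.npα p x - KNdS.npπ p x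
              - Complex.I * q' * KNdS.potFrame p 3 x) * P 1 x)
          = -Complex.I * mass * conj (Q 1 x))) ∧
      -- the directional derivatives on fields `e^{i(mφ - ωt)} f(r, θ)`
      (∀ f : ℝ → ℝ → ℂ,
        KNdS.frameDeriv p 0 (fun y => KNdS.modePhase m ω y * f (y 1) (y 2)) x =
          KNdS.modePhase m ω x * (deriv (fun r => f r (x 2)) (x 1) +
            Complex.I * KNdS.Xi p / KNdS.Dr p (x 1) * KNdS.K p m ω (x 1) * f (x 1) (x 2)) ∧
        KNdS.frameDeriv p 1 (fun y => KNdS.modePhase m ω y * f (y 1) (y 2)) x =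
          KNdS.modePhase m ω x * (-KNdS.Dr p (x 1) / (2 * KNdS.rhoSq p (x 1) (x 2)) *
            (deriv (fun r => f r (x 2)) (x 1) -
              Complex.I * KNdS.Xi p * KNdS.K p m ω (x 1) / KNdS.Dr p (x 1) * f (x 1) (x 2))) ∧
        KNdS.frameDeriv p 2 (fun y => KNdS.modePhase m ω y * f (y 1) (y 2)) x =
          KNdS.modePhase m ω x *
            ((√(KNdS.Dθ p (x 2)) : ℝ) / ((√2 : ℝ) * KNdS.rhoBar p (x 1) (x 2)) *
            (deriv (f (x 1)) (x 2) +
              KNdS.Xi p * KNdS.H p m ω (x 2) / KNdS.Dθ p (x 2) * f (x 1) (x 2))) ∧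
        KNdS.frameDeriv p 3 (fun y => KNdS.modePhase m ω y * f (y 1) (y 2)) x =
          KNdS.modePhase m ω x *
            ((√(KNdS.Dθ p (x 2)) : ℝ) / ((√2 : ℝ) * conj (KNdS.rhoBar p (x 1) (x 2))) *
            (deriv (f (x 1)) (x 2) -
              KNdS.Xi p * KNdS.H p m ω (x 2) / KNdS.Dθ p (x 2) * f (x 1) (x 2))))) ∧
    -- the separation, on a region `r ∈ I`, `θ ∈ J`
    (∀ (I J : Set ℝ), IsOpen I → IsOpen J → J ⊆ Set.Ioo 0 Real.pi →
      (∀ r ∈ I, 0 < KNdS.Dr p r) → (∀ θ ∈ J, 0 < KNdS.Dθ p θ) →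
      (∀ r ∈ I, ∀ θ ∈ J, KNdS.rhoSq p r θ ≠ 0) →
      ∀ Rm Rp Sm Sp : ℝ → ℂ,
      (∀ r ∈ I, DifferentiableAt ℝ Rm r ∧ DifferentiableAt ℝ Rp r) →
      (∀ θ ∈ J, DifferentiableAt ℝ Sm θ ∧ DifferentiableAt ℝ Sp θ) →
      -- solutions of the separated equations give solutions of the Dirac equation
      (∀ lam : ℂ, (∀ r ∈ I, KNdS.RadialEqs p q μ m ω lam Rm Rp r) →
        (∀ θ ∈ J, KNdS.AngularEqs p μ m ω lam Sm Sp θ) →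
        ∀ x : KNdS.Point, x 1 ∈ I → x 2 ∈ J →
          KNdS.Dirac p q (μ / √2) (KNdS.ansatzP p m ω Rm Rp Sm Sp)
            (KNdS.conjSpinor (KNdS.ansatzQbar p m ω Rm Rp Sm Sp)) x) ∧
      -- a nontrivial product solution of the Dirac equation separates
      ((∃ r ∈ I, Rm r ≠ 0 ∨ Rp r ≠ 0) → (∃ θ ∈ J, Sm θ ≠ 0 ∨ Sp θ ≠ 0) →
        (∀ x : KNdS.Point, x 1 ∈ I → x 2 ∈ J →
          KNdS.Dirac p q (μ / √2) (KNdS.ansatzP p m ω Rm Rp Sm Sp)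
            (KNdS.conjSpinor (KNdS.ansatzQbar p m ω Rm Rp Sm Sp)) x) →
        ∃ lam : ℂ, (∀ r ∈ I, KNdS.RadialEqs p q μ m ω lam Rm Rp r) ∧
          (∀ θ ∈ J, KNdS.AngularEqs p μ m ω lam Sm Sp θ)) ∧
      -- for `Λ = 0` the separated equations are the Kerr–Newman ones
      (p.Λ = 0 → ∀ lam : ℂ,
        (∀ r ∈ I, KNdS.RadialEqs p q μ m ω lam Rm Rp r ↔
          KNdS.KNRadialEqs p q μ m ω lam Rm Rp r) ∧
        (∀ θ ∈ J, KNdS.AngularEqs p μ m ω lam Sm Sp θ ↔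
          KNdS.KNAngularEqs p μ m ω lam Sm Sp θ) ∧
        ((∀ r ∈ I, KNdS.RadialEqs p q μ m ω lam Rm Rp r) →
          ∀ r ∈ I, lam + Complex.I * μ * r ≠ 0 →
            DifferentiableAt ℝ (deriv Rm) r ∧ KNdS.PageRadial p q μ m ω lam Rm r) ∧
        ((∀ θ ∈ J, KNdS.AngularEqs p μ m ω lam Sm Sp θ) →
          ∀ θ ∈ J, lam + μ * p.a * Real.cos θ ≠ 0 →
            DifferentiableAt ℝ (deriv Sm) θ ∧ KNdS.PageAngular p μ m ω lam Sm θ))) := by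
  refine ⟨fun x hDr h0 hπ hDθ hρ => ?_, fun I J hI hJ hJπ hDr hDθ hρ Rm Rp Sm Sp hR hS => ?_⟩
  · have h : KNdS.Regular p (x 1) (x 2) :=
      ⟨hXi, hDr, (Real.sin_pos_of_pos_of_lt_pi h0 hπ).ne', hDθ, hρ⟩
    obtain ⟨eκ, eσ, eν, elam, eε, eπ, eβ, eγ, eρ, eμ, eτ, eα⟩ :=
      KNdS.spinCoefficients h rfl rfl rfl rfl rfl rfl rfl
    have ht : ((√2 : ℝ) : ℂ) ^ 2 = 2 := by norm_cast; simp
    have nt : ((√2 : ℝ) : ℂ) ≠ 0 := by simp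
    have ns : (Real.sin (x 2) : ℂ) ≠ 0 := by exact_mod_cast h.sin
    have nB := KNdS.rhoBar_ne_zero hρ
    have nB' := KNdS.conj_rhoBar_ne_zero hρ
    have hw : √(2 * KNdS.Dθ p (x 2)) = KNdS.sqrtTwoDθ p (x 2) := rfl
    refine ⟨KNdS.tetrad_null h, eκ, eσ, eν, elam, eε, ?_, ?_, ?_, eρ, ?_, ?_, ?_,
      fun q' mass P Q => KNdS.halfDirac_iff p x q' mass P Q,
      fun f => KNdS.frameDeriv_mode h m ω f⟩
    · rw [eπ, hw]
      ring
    · rw [eβ]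
      push_cast
      simp only [← Complex.ofReal_sin]
      field_simp
      -- The derivative of `w sin θ` carries a factor `√2`, and `√2 / 4 = 1 / (2√2)`.
      linear_combination 2 * (KNdS.dSqrtSin p (x 2) : ℂ) * ht
    · rw [eγ, KNdS.rhoBar_mul_conj]
      ring
    · rw [eμ, KNdS.rhoBar_mul_conj]
    · rw [eτ, KNdS.rhoBar_mul_conj, hw]
      ring
    · rw [eα, eπ, eβ]
      simp only [map_div₀, map_mul, Complex.conj_ofReal, map_ofNat]
  · have hsin : ∀ θ ∈ J, Real.sin θ ≠ 0 := fun θ hθ =>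
      (Real.sin_pos_of_pos_of_lt_pi (hJπ hθ).1 (hJπ hθ).2).ne'
    have hdirac : ∀ x : KNdS.Point, x 1 ∈ I → x 2 ∈ J → _ := fun x h1 h2 =>
      KNdS.dirac_ansatz_iff ⟨hXi, (hDr _ h1).ne', hsin _ h2, hDθ _ h2, hρ _ h1 _ h2⟩ (hDr _ h1)
        q μ m ω (hR _ h1).1 (hR _ h1).2 (hS _ h2).1 (hS _ h2).2
    refine ⟨fun lam hrad hang x h1 h2 => ?_, fun hRne hSne hsol => ?_, fun hΛ lam => ?_⟩
    · obtain ⟨r1, r2⟩ := (KNdS.radialEqs_iff (hDr _ h1) q μ m ω lam Rm Rp).1 (hrad _ h1)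
      obtain ⟨a1, a2⟩ := (KNdS.angularEqs_iff (hDθ _ h2) μ m ω lam Sm Sp).1 (hang _ h2)
      rw [hdirac x h1 h2, r1, r2, a1, a2]
      refine ⟨⟨?_, ?_⟩, ?_, ?_⟩ <;> ring
    · obtain ⟨lam, h1, h2⟩ := KNdS.exists_separation_constant hRne hSne
        -- The phase has dropped out of the pointwise relations, so the points with `t = φ = 0`
        -- suffice.
        (fun r hr θ hθ => (hdirac ![0, r, θ, 0] hr hθ).1 (hsol ![0, r, θ, 0] hr hθ))
      exact ⟨lam, fun r hr => (KNdS.radialEqs_iff (hDr r hr) q μ m ω lam Rm Rp).2 (h1 r hr),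
        fun θ hθ => (KNdS.angularEqs_iff (hDθ θ hθ) μ m ω lam Sm Sp).2 (h2 θ hθ)⟩
    · have hrad := KNdS.radialEqs_iff_KN hΛ q μ m ω lam Rm Rp
      have hang := KNdS.angularEqs_iff_KN hΛ μ m ω lam Sm Sp
      refine ⟨fun r _ => hrad r, fun θ _ => hang θ, fun h r hr hlam => ?_, fun h θ hθ hlam => ?_⟩
      · refine KNdS.pageRadial_of_KNRadialEqs hI (fun s hs => ?_) hR
          (fun s hs => (hrad s).1 (h s hs)) hr hlam
        rw [← KNdS.Dr_of_Λ_eq_zero hΛ]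
        exact hDr s hs
      · exact KNdS.pageAngular_of_KNAngularEqs hJ hsin hS (fun s hs => (hang s).1 (h s hs)) hθ hlam
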